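/- Consider the optimal contract problem with action set $[n]=\{1,\dots,n\}$, a reward function $f:2^{[n]}\to[0,1]$ and a cost function $c:2^{[n]}\to\mathbb{R}_{\ge 0}$. A best response to a contract $\alpha\in[0,1]$ is a set $S_\alpha\subseteq[n]$ that maximizes $\alpha f(S)-c(S)$, ties being broken in favor of the higher value of $f$. A contract $\alpha^\star\in[0,1]$ is optimal if it maximizes $(1-\alpha)f(S_\alpha)$ over $\alpha\in[0,1]$. Alice holds $f$ and Bob holds $c$. They run a two-party protocol with shared randomness in which they exchange bits. Each party may also, privately and adaptively, query a best-response oracle, which answers a contract $\alpha\in[0,1]$ with a best response to $\alpha$ (how ties that remain after the tie-breaking are resolved is fixed arbitrarily). A bit sent by a party depends on its input, the shared randomness, the transcript, and the answers to its own queries. When the communication ends, one of the parties, determined by the transcript and the shared randomness, outputs a contract. For $b\in\mathbb{N}$, let $\mathcal{I}_{n,b}$ be the set of instances $\langle n,f,c\rangle$ for which $f$ and $c$ are both monotone and submodular and all their values are rational numbers whose numerators and denominators have at most $b$ bits. The protocol computes the optimal contract on $\mathcal{I}_{n,b}$ if on every instance in $\mathcal{I}_{n,b}$ its output is an optimal contract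 with probability at least $2/3$. **Theorem.** There are a polynomial $b$ and a constant $\kappa>0$ such that for every polynomial $q$ there is an $n_0$ such that for all $n\ge n_0$: any protocol that computes the optimal contract on $\mathcal{I}_{n,b(n)}$ and makes at most $q(n)$ best-response queries exchanges at least $\kappa\cdot 2^n/\sqrt{n}$ bits on some instance in $\mathcal{I}_{n,b(n)}$, for some outcome of the shared randomness. In other words, when $f$ and $c$ are both submodular, computing the optimal contract with $\mathrm{poly}(n)$ best-response queries requires $\Omega(2^n/\sqrt{n})$ bits of communication, even if all numbers are represented with $\mathrm{poly}(n)$ bits. -/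

import Mathlib

open MeasureTheory

namespace TwoPartyContract

/-- A real-valued set function on the set of actions `[n]`. -/
abbrev SetFun (n : ℕ) : Type := Finset (Fin n) → ℝ

/-- Submodularity: the marginal value of an action decreases as the set grows. -/
def IsSubmodular {n : ℕ} (v : SetFun n) : Prop :=
  ∀ S T : Finset (Fin n), S ⊆ T → ∀ i, i ∉ T →
    v (insert i T) - v T ≤ v (insert i S) - v S

/-- `x` is a rational number whose numerator (in absolute value) and denominator are written with
at most `b` bits each. -/
def HasBits (b : ℕ) (x : ℝ) : Prop :=
  ∃ r : ℚ, (r : ℝ) = x ∧ r.num.natAbs < 2 ^ b ∧ r.den < 2 ^ b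

/-- Instances of the optimal contract problem with `n` actions, in which the reward function
`f : 2^[n] → [0, 1]` and the cost function `c : 2^[n] → ℝ≥0` are monotone and submodular, and all
of their values are represented with `b` bits. -/
structure IsInstance (n b : ℕ) (f c : SetFun n) : Prop where
  reward_mem : ∀ S, f S ∈ Set.Icc (0 : ℝ) 1
  cost_nonneg : ∀ S, 0 ≤ c S
  reward_mono : Monotone f
  cost_mono : Monotone c
  reward_submodular : IsSubmodular f
  cost_submodular : IsSubmodular c
  reward_bits : ∀ S, HasBits b (f S)
  cost_bits : ∀ S, HasBits b (c S)

/-- `S` is a best response of the agent to the contract `α`: it maximizes the agent's utility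
`α * f S - c S`, ties being broken in favor of the higher reward. -/
def IsBestResponse {n : ℕ} (f c : SetFun n) (α : ℝ) (S : Finset (Fin n)) : Prop :=
  (∀ T, α * f T - c T ≤ α * f S - c S) ∧
    ∀ T, α * f T - c T = α * f S - c S → f T ≤ f S

/-- `α` is an optimal contract: it lies in `[0, 1]` and maximizes over `[0, 1]` the principal's
utility `(1 - α) * f (S_α)`, where `S_α` is a best response to `α`. -/
def IsOptimalContract {n : ℕ} (f c : SetFun n) (α : ℝ) : Prop :=
  α ∈ Set.Icc (0 : ℝ) 1 ∧ ∃ S, IsBestResponse f c α S ∧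
    ∀ β ∈ Set.Icc (0 : ℝ) 1, ∀ T, IsBestResponse f c β T → (1 - β) * f T ≤ (1 - α) * f S

/-- A best-response oracle: given an instance, it answers a contract `α ∈ [0, 1]` with a best
response to `α` (the choice among best responses with the same reward is up to the oracle). -/
structure BestResponseOracle (n : ℕ) where
  answer : SetFun n → SetFun n → Set.Icc (0 : ℝ) 1 → Finset (Fin n)
  isBestResponse : ∀ (f c : SetFun n) (α : Set.Icc (0 : ℝ) 1),
    IsBestResponse f c (α : ℝ) (answer f c α)

/-- A local computation of one party: it adaptively asks finitely many best-response queries and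
then returns an element of `β`. -/
inductive QueryComp (n : ℕ) (β : Type) : Type where
  | done (x : β) : QueryComp n β
  | ask (α : Set.Icc (0 : ℝ) 1) (next : Finset (Fin n) → QueryComp n β) : QueryComp n β

/-- Run a local computation with the answers of an oracle; the result is the returned value
together with the list of the answers received, one for each query asked. -/
def QueryComp.run {n : ℕ} {β : Type} (br : Set.Icc (0 : ℝ) 1 → Finset (Fin n)) :
    QueryComp n β → β × List (Finset (Fin n))
  | .done x => (x, [])
  | .ask α next =>
    (((next (br α)).run br).1, br α :: ((next (br α)).run br).2)

/-- The two parties: Alice holds `f` and Bob holds `c`. -/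
inductive Party : Type where
  | alice : Party
  | bob : Party
  deriving DecidableEq

/-- A deterministic two-party protocol with private access to a best-response oracle. The nodes of
the protocol tree are the transcripts of the bits exchanged so far. At a node `send p msg next`
the party `p` sends one bit, found by a local computation from its own input and the answers to its
own earlier queries. At a leaf `output p out` the party `p` outputs a contract in the same way. -/
inductive Protocol (n : ℕ) : Type where
  | output (p : Party)
      (out : SetFun n → List (Finset (Fin n)) → QueryComp n ℝ) : Protocol n
  | send (p : Party)
      (msg : SetFun n → List (Finset (Fin n)) → QueryComp n Bool)
      (next : Bool → Protocol n) : Protocol n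

/-- The outcome of an execution: the output, the number of bits exchanged, and the number of
best-response queries made by the two parties together. -/
structure Outcome : Type where
  contract : ℝ
  bits : ℕ
  queries : ℕ

/-- The input of each party. -/
def partyInput {n : ℕ} (f c : SetFun n) : Party → SetFun n
  | .alice => f
  | .bob => c

/-- Execution of a protocol; `mem p` lists the answers that party `p` has received so far. -/
def Protocol.exec {n : ℕ} (br : Set.Icc (0 : ℝ) 1 → Finset (Fin n)) (f c : SetFun n) :
    Protocol n → (Party → List (Finset (Fin n))) → Outcome
  | .output p out, mem =>
    let r := (out (partyInput f c p) (mem p)).run br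
    ⟨r.1, 0, r.2.length⟩
  | .send p msg next, mem =>
    let r := (msg (partyInput f c p) (mem p)).run br
    let e := (next r.1).exec br f c (Function.update mem p (mem p ++ r.2))
    ⟨e.contract, e.bits + 1, e.queries + r.2.length⟩

/-- Execution of a protocol on the instance `⟨n, f, c⟩` from the start, with the oracle `O`. -/
def Protocol.run {n : ℕ} (P : Protocol n) (O : BestResponseOracle n) (f c : SetFun n) : Outcome :=
  P.exec (O.answer f c) f c (fun _ => [])

/-- A randomized protocol with shared randomness `ω`, distributed by `μ`, is a family
`P ω` of deterministic protocols. It computes the optimal contract (with error `1 / 3`) if on every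
instance its output is an optimal contract with probability at least `2 / 3`. -/
def ComputesOptimalContract {n : ℕ} (b : ℕ) (O : BestResponseOracle n) {Ω : Type}
    [MeasurableSpace Ω] (μ : Measure Ω) (P : Ω → Protocol n) : Prop :=
  ∀ f c : SetFun n, IsInstance n b f c →
    MeasurableSet {ω | IsOptimalContract f c ((P ω).run O f c).contract} ∧
      2 / 3 ≤ μ {ω | IsOptimalContract f c ((P ω).run O f c).contract}

/-- On every instance and for all random choices, at most `q` best-response queries are made. -/
def MakesAtMostQueries {n : ℕ} (b : ℕ) (O : BestResponseOracle n) {Ω : Type}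
    (P : Ω → Protocol n) (q : ℕ) : Prop :=
  ∀ f c : SetFun n, IsInstance n b f c → ∀ ω, ((P ω).run O f c).queries ≤ q

end TwoPartyContract

open TwoPartyContract

/-! The bound is a reduction from set disjointness on `N = M / 2` bits, where `M` is the number of
sets of size `n / 2`, of order `2 ^ n / √n`.

Hard instance. A strictly concave function of the size, of huge weight, makes all responses other
than the empty set lie on the middle level, and leaves room for small arbitrary perturbations there
without loss of monotonicity or submodularity. Write `X` for `midReward n` and `s = (2α - 1) X` for
`position n α`. The middle set number `j` gets reward about `X + j` and a cost for which it replaces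
number `j - 1` near `s = j`. The principal's utility there is, up to scaling, `(X - s)(X + j) ≈ X ^
2 - j ^ 2`, and since `M ^ 2` is small against `X`, no `j` is preferred to leading order. Alice's
bit raises the reward of a set and Bob's bit lowers its cost, by `1 / (16 X)`. Both let the agent
switch to this set at a smaller contract. With both bits the gain exceeds that of any set with at
most one, so when the inputs intersect an optimal contract points to an intersection
(`bits_of_isOptimalContract`).

Queries are cheap. Bits sit only at odd numbers, so a best response depends on the two bits at a
single index (`bestResponse_eq`). Adding this index and these bits to the transcript for every
query, and for the output, costs `n + O(1)` bits each. The resulting records have rectangular fibers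
(`Protocol.record_rectangle`), and the last two bits of a record certify an intersection.

Disjointness (`sum_accept_le`). Inputs are drawn by giving each coordinate at random to one party,
with a random bit, and planting an intersection at one coordinate. A certificate has no mass without
the planted intersection, so its mass is bounded by a squared Hellinger distance between the laws of
the record at `(1, 1)` and `(0, 0)`. By cut and paste this equals the distance between `(1, 0)` and
`(0, 1)`, hence is controlled by the distances of these two from `(0, 0)`. Summed over the
coordinates, the latter are bounded by the logarithm of the number of records, through the level-one
inequality (`sum_hellinger_le`). Success with probability `2 / 3` on all planted inputs thus forces
records of length linear in `N`. -/

namespace TwoPartyContract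
open Finset

/-! ### Set disjointness for functions with rectangular fibers, by Hellinger distances. -/

section Disjointness

variable {ι τ : Type*} [Fintype ι] [DecidableEq ι] [DecidableEq τ]

/-- The value `±1` of a bit. -/
noncomputable def signBit (b : Bool) : ℝ := if b then 1 else -1

/-- The level-one inequality for a set of points of the cube. -/
theorem sum_sq_mean_signBit_le (R : Finset (ι → Bool)) (hR : R.Nonempty) :
    ∑ i, ((∑ z ∈ R, signBit (z i)) / #R) ^ 2 ≤
      2 * Real.log (2 ^ Fintype.card ι / #R) := by
  have hc : (0 : ℝ) < #R := by exact_mod_cast hR.card_pos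
  set v : ι → ℝ := fun i => (∑ z ∈ R, signBit (z i)) / #R with hv
  set V : ℝ := ∑ i, v i ^ 2 with hV
  -- The linear form in the direction of the mean of `R` averages to `V` on `R`, while its
  -- exponential moment over the whole cube factorizes. Comparing the two bounds `V`.
  let φ : (ι → Bool) → ℝ := fun z => ∑ i, v i * signBit (z i)
  have hφ : ∑ z ∈ R, φ z = #R * V := by
    simp only [φ]
    rw [sum_comm, hV, mul_sum]
    refine sum_congr rfl fun i _ => ?_
    rw [← mul_sum]
    have : ∑ z ∈ R, signBit (z i) = #R * v i := by
      simp only [hv]; field_simp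
    rw [this]; ring
  have hlow : Real.exp V * #R ≤ ∑ z ∈ R, Real.exp (φ z) := by
    -- Jensen's inequality, through the tangent of `exp` at `V`.
    have h1 : ∀ z ∈ R, Real.exp V * (1 + φ z - V) ≤ Real.exp (φ z) := by
      intro z _
      have h2 := Real.add_one_le_exp (φ z - V)
      have h3 : Real.exp (φ z) = Real.exp V * Real.exp (φ z - V) := by
        rw [← Real.exp_add]; congr 1; ring
      rw [h3]
      exact mul_le_mul_of_nonneg_left (by linarith) (Real.exp_pos V).le
    refine le_trans (le_of_eq ?_) (sum_le_sum h1)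
    rw [← mul_sum, sum_sub_distrib, sum_add_distrib, hφ]
    simp only [sum_const, nsmul_eq_mul]
    ring
  have hall : ∑ z : ι → Bool, Real.exp (φ z) = ∏ i, (2 * Real.cosh (v i)) := by
    have h := Finset.prod_univ_sum (fun _ : ι => (univ : Finset Bool))
      (fun i b => Real.exp (v i * signBit b))
    rw [Fintype.piFinset_univ] at h
    simp only [φ, Real.exp_sum]
    rw [← h]
    refine prod_congr rfl fun i _ => ?_
    simp [signBit, Real.cosh_eq]
    ring
  have hup : ∑ z ∈ R, Real.exp (φ z) ≤ 2 ^ Fintype.card ι * Real.exp (V / 2) := by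
    calc ∑ z ∈ R, Real.exp (φ z) ≤ ∑ z : ι → Bool, Real.exp (φ z) :=
          sum_le_sum_of_subset_of_nonneg (subset_univ _) fun _ _ _ => (Real.exp_pos _).le
      _ = ∏ i, (2 * Real.cosh (v i)) := hall
      _ ≤ ∏ i, (2 * Real.exp (v i ^ 2 / 2)) := by
          refine prod_le_prod (fun i _ => by positivity) fun i _ => ?_
          exact mul_le_mul_of_nonneg_left (Real.cosh_le_exp_half_sq _) (by norm_num)
      _ = 2 ^ Fintype.card ι * Real.exp (V / 2) := by
          rw [prod_mul_distrib, prod_const, card_univ, ← Real.exp_sum, hV, sum_div]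
  have hexp : Real.exp V = Real.exp (V / 2) * Real.exp (V / 2) := by
    rw [← Real.exp_add]; congr 1; ring
  have hfin : Real.exp (V / 2) ≤ 2 ^ Fintype.card ι / #R := by
    rw [le_div_iff₀ hc]
    have h := hlow.trans hup
    rw [hexp] at h
    have hp := Real.exp_pos (V / 2)
    refine le_of_mul_le_mul_left ?_ hp
    linarith
  have := (Real.le_log_iff_exp_le (by positivity)).2 hfin
  linarith

theorem sq_sqrt_sub_sqrt_le {a b : ℝ} (ha : 0 ≤ a) (hb : 0 ≤ b) (hab : 0 < a + b) :
    (√a - √b) ^ 2 ≤ (a - b) ^ 2 / (a + b) := by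
  rw [le_div_iff₀ hab]
  have h1 := Real.sq_sqrt ha
  have h2 := Real.sq_sqrt hb
  have h3 : 0 ≤ √a * √b := by positivity
  have h4 : (a - b) ^ 2 = (√a - √b) ^ 2 * (√a + √b) ^ 2 := by
    rw [← mul_pow]; congr 1; nlinarith
  rw [h4]
  refine mul_le_mul_of_nonneg_left ?_ (sq_nonneg _)
  nlinarith

/-- Resampling the coordinate `i` to `b` is conditioning on it, and the factor 2 is the inverse
probability of the condition. -/
theorem card_filter_update (i : ι) (b : Bool) (p : (ι → Bool) → Prop) [DecidablePred p] :
    #{z : ι → Bool | p (Function.update z i b)} = 2 * #{z : ι → Bool | p z ∧ z i = b} := by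
  have hsplit : #{z : ι → Bool | p (Function.update z i b)} =
      #{z : ι → Bool | p (Function.update z i b) ∧ z i = b} +
      #{z : ι → Bool | p (Function.update z i b) ∧ ¬ z i = b} := by
    rw [← filter_filter, ← filter_filter, card_filter_add_card_filter_not]
  have h1 : #{z : ι → Bool | p (Function.update z i b) ∧ z i = b} =
      #{z : ι → Bool | p z ∧ z i = b} := by
    congr 1
    ext z
    simp only [mem_filter, mem_univ, true_and]
    refine and_congr_left fun h => ?_
    rw [← h, Function.update_eq_self]
  have h2 : #{z : ι → Bool | p (Function.update z i b) ∧ ¬ z i = b} =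
      #{z : ι → Bool | p z ∧ z i = b} := by
    refine card_bij' (fun z _ => Function.update z i b) (fun z _ => Function.update z i (!b))
      ?_ ?_ ?_ ?_
    · intro z hz; simp at hz ⊢; exact hz.1
    · intro z hz
      simp only [mem_filter, mem_univ, true_and] at hz ⊢
      have : Function.update z i b = z := by rw [← hz.2, Function.update_eq_self]
      simp [this, hz.1]
    · intro z hz
      simp only [mem_filter, mem_univ, true_and] at hz
      have : (!b) = z i := by cases hb : b <;> cases hz' : z i <;> simp_all
      simp [this]
    · intro z hz
      simp only [mem_filter, mem_univ, true_and] at hz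
      simp [← hz.2]
  omega

/-- Over a partition of the cube into few classes, the squared Hellinger distances between the
laws of the class conditioned on the two values of a coordinate sum to little. -/
theorem sum_hellinger_le (g : (ι → Bool) → τ) (K : Finset τ) (hK : ∀ z, g z ∈ K) :
    ∑ i, ∑ t ∈ K, (√(#{z | g (Function.update z i true) = t} : ℝ) -
        √(#{z | g (Function.update z i false) = t} : ℝ)) ^ 2 ≤
      4 * 2 ^ Fintype.card ι * Real.log #K := by
  set c : ℝ := 2 ^ Fintype.card ι with hc
  have hc0 : 0 < c := by positivity
  have hKpos : (0 : ℝ) < #K := by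
    exact_mod_cast card_pos.2 ⟨_, hK fun _ => true⟩
  let R : τ → Finset (ι → Bool) := fun t => {z | g z = t}
  have hsumR : ∑ t ∈ K, (#(R t) : ℝ) = c := by
    have := card_eq_sum_card_fiberwise (f := g) (s := (univ : Finset (ι → Bool))) (t := K)
      (fun z _ => hK z)
    simp only [card_univ, Fintype.card_fun, Fintype.card_bool] at this
    simp only [R, hc]
    exact_mod_cast this.symm
  have hterm : ∀ t ∈ K, ∑ i, (√(#{z | g (Function.update z i true) = t} : ℝ) -
        √(#{z | g (Function.update z i false) = t} : ℝ)) ^ 2 ≤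
      4 * (c / #K - #(R t) + #(R t) * Real.log #K) := by
    intro t _
    rcases (R t).eq_empty_or_nonempty with h0 | hne
    · have hz : ∀ z, ¬ g z = t := by
        intro z hz
        have : z ∈ R t := by simp [R, hz]
        simp [h0] at this
      simp only [hz, h0]
      simp
      positivity
    have hr : (0 : ℝ) < #(R t) := by exact_mod_cast hne.card_pos
    have hi : ∀ i, (√(#{z | g (Function.update z i true) = t} : ℝ) -
        √(#{z | g (Function.update z i false) = t} : ℝ)) ^ 2 ≤
        2 * #(R t) * ((∑ z ∈ R t, signBit (z i)) / #(R t)) ^ 2 := by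
      intro i
      rw [card_filter_update i true (fun z => g z = t),
        card_filter_update i false (fun z => g z = t)]
      set r1 := #{z | g z = t ∧ z i = true}
      set r0 := #{z | g z = t ∧ z i = false}
      have hadd : (r1 : ℝ) + r0 = #(R t) := by
        have := card_filter_add_card_filter_not (s := R t) (fun z => z i = true)
        simp only [R, filter_filter, Bool.not_eq_true] at this
        simp only [R]
        exact_mod_cast this
      have hdiff : ∑ z ∈ R t, signBit (z i) = r1 - r0 := by
        simp only [signBit, sum_ite, sum_const, nsmul_eq_mul, R, filter_filter,
          Bool.not_eq_true]
        ring
      rw [hdiff]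
      refine (sq_sqrt_sub_sqrt_le (by positivity) (by positivity) ?_).trans (le_of_eq ?_)
      · push_cast; linarith
      · push_cast
        rw [← mul_add, hadd]
        field_simp
    calc _ ≤ ∑ i, 2 * #(R t) * ((∑ z ∈ R t, signBit (z i)) / #(R t)) ^ 2 :=
          sum_le_sum fun i _ => hi i
      _ = 2 * #(R t) * ∑ i, ((∑ z ∈ R t, signBit (z i)) / #(R t)) ^ 2 := by rw [mul_sum]
      _ ≤ 2 * #(R t) * (2 * Real.log (c / #(R t))) :=
          mul_le_mul_of_nonneg_left (sum_sq_mean_signBit_le _ hne) (by positivity)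
      -- The sum over `t` is `4c` times the entropy of the class. Splitting off `#K` compares it
      -- with the uniform law; the linear terms left by `log x ≤ x - 1` cancel on summation.
      _ = 4 * (#(R t) * Real.log (c / #(R t) / #K * #K)) := by
          rw [div_mul_cancel₀ _ hKpos.ne']; ring
      _ = 4 * (#(R t) * (Real.log (c / #(R t) / #K) + Real.log #K)) := by
          rw [Real.log_mul (by positivity) (by positivity)]
      _ ≤ 4 * (#(R t) * ((c / #(R t) / #K - 1) + Real.log #K)) := by
          gcongr
          exact Real.log_le_sub_one_of_pos (by positivity)
      _ = _ := by field_simp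
  rw [sum_comm]
  refine (sum_le_sum hterm).trans (le_of_eq ?_)
  rw [← mul_sum, sum_add_distrib, sum_sub_distrib, ← sum_mul, hsumR, sum_const, nsmul_eq_mul]
  field_simp
  ring

/-- The first party's part of the free bits `z`. -/
def leftPart (d z : ι → Bool) : ι → Bool := fun j => d j && z j

/-- The second party's part of the free bits `z`. -/
def rightPart (d z : ι → Bool) : ι → Bool := fun j => !d j && z j

/-- The number of choices of the free bits that lead to the class `t` when the coordinate `i`
carries the bits `a` and `b`. -/
def fiberCount (T : (ι → Bool) → (ι → Bool) → τ) (d : ι → Bool) (i : ι) (a b : Bool) (t : τ) : ℕ :=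
  #{z | T (Function.update (leftPart d z) i a) (Function.update (rightPart d z) i b) = t}

/-- The left input sees `z` only where `d` holds and the right input only elsewhere. Exchanging the
coordinates of `z` and `z'` outside `d` therefore exchanges the right inputs of two points, and
rectangularity keeps both in the class `t`. -/
theorem fiberCount_cut_paste {T : (ι → Bool) → (ι → Bool) → τ}
    (hrect : ∀ a b a' b', T a b = T a' b' → T a b' = T a b) (d : ι → Bool) (i : ι) (t : τ) :
    fiberCount T d i false false t * fiberCount T d i true true t =
      fiberCount T d i false true t * fiberCount T d i true false t := by
  have hl : ∀ z z' : ι → Bool, leftPart d (fun j => if d j then z j else z' j) = leftPart d z := by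
    intro z z'; ext j; cases h : d j <;> simp [leftPart, h]
  have hr : ∀ z z' : ι → Bool,
      rightPart d (fun j => if d j then z j else z' j) = rightPart d z' := by
    intro z z'; ext j; cases h : d j <;> simp [rightPart, h]
  have hcut : ∀ a b a' b', T a b = t → T a' b' = t → T a b' = t := by
    intro a b a' b' h h'
    rw [hrect a b a' b' (h.trans h'.symm), h]
  unfold fiberCount
  rw [← card_product, ← card_product]
  refine card_bij'
    (fun w _ => (fun j => if d j then w.1 j else w.2 j, fun j => if d j then w.2 j else w.1 j))
    (fun w _ => (fun j => if d j then w.1 j else w.2 j, fun j => if d j then w.2 j else w.1 j))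
    ?_ ?_ ?_ ?_
  · rintro ⟨z, z'⟩ h
    simp only [mem_product, mem_filter, mem_univ, true_and, hl, hr] at h ⊢
    exact ⟨hcut _ _ _ _ h.1 h.2, hcut _ _ _ _ h.2 h.1⟩
  · rintro ⟨z, z'⟩ h
    simp only [mem_product, mem_filter, mem_univ, true_and, hl, hr] at h ⊢
    exact ⟨hcut _ _ _ _ h.1 h.2, hcut _ _ _ _ h.2 h.1⟩
  · rintro ⟨z, z'⟩ _
    ext j <;> cases h : d j <;> simp [h]
  · rintro ⟨z, z'⟩ _
    ext j <;> cases h : d j <;> simp [h]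

theorem sum_fiberCount {T : (ι → Bool) → (ι → Bool) → τ} {K : Finset τ} (hK : ∀ a b, T a b ∈ K)
    (d : ι → Bool) (i : ι) (a b : Bool) :
    ∑ t ∈ K, (fiberCount T d i a b t : ℝ) = 2 ^ Fintype.card ι := by
  have := card_eq_sum_card_fiberwise
    (f := fun z => T (Function.update (leftPart d z) i a) (Function.update (rightPart d z) i b))
    (s := (univ : Finset (ι → Bool))) (t := K) (fun z _ => hK _ _)
  simp only [card_univ, Fintype.card_fun, Fintype.card_bool] at this
  simp only [fiberCount]
  exact_mod_cast this.symm

theorem update_leftPart {σ : Type*} [DecidableEq σ] (d z : σ → Bool) (i : σ) (e a : Bool) :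
    Function.update (leftPart (Function.update d i e) z) i a =
      Function.update (leftPart d z) i a := by
  ext j; by_cases h : j = i
  · subst h; simp
  · simp [leftPart, h]

theorem update_rightPart {σ : Type*} [DecidableEq σ] (d z : σ → Bool) (i : σ) (e a : Bool) :
    Function.update (rightPart (Function.update d i e) z) i a =
      Function.update (rightPart d z) i a := by
  ext j; by_cases h : j = i
  · subst h; simp
  · simp [rightPart, h]

/-- Coordinate `i` is overwritten on both sides, so `d i` only selects which party's flip
`hellingerAt` measures. Both flips can thus be compared with the same law at `(false, false)`. -/
theorem fiberCount_update (T : (ι → Bool) → (ι → Bool) → τ) (d : ι → Bool) (i : ι) (e a b : Bool)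
    (t : τ) : fiberCount T (Function.update d i e) i a b t = fiberCount T d i a b t := by
  simp only [fiberCount, update_leftPart, update_rightPart]

/-- The squared Hellinger distance, in the direction `d i`, at the coordinate `i`. -/
noncomputable def hellingerAt (T : (ι → Bool) → (ι → Bool) → τ) (K : Finset τ) (d : ι → Bool) (i : ι) : ℝ :=
  ∑ t ∈ K, (√(fiberCount T d i (d i) (!d i) t : ℝ) - √(fiberCount T d i false false t : ℝ)) ^ 2

/-- For fixed `d` both inputs are functions of `z`, and flipping `z i` flips coordinate `i` of the
party that owns it. This is the partition bound on the cube of all `z`. -/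
theorem sum_hellingerAt_le {T : (ι → Bool) → (ι → Bool) → τ} {K : Finset τ}
    (hK : ∀ a b, T a b ∈ K) (d : ι → Bool) :
    ∑ i, hellingerAt T K d i ≤ 4 * 2 ^ Fintype.card ι * Real.log #K := by
  refine le_trans (le_of_eq ?_)
    (sum_hellinger_le (fun z => T (leftPart d z) (rightPart d z)) K fun z => hK _ _)
  refine sum_congr rfl fun i _ => sum_congr rfl fun t _ => ?_
  have key : ∀ e : Bool, (#{z | T (leftPart d (Function.update z i e))
      (rightPart d (Function.update z i e)) = t}) =
      fiberCount T d i (d i && e) (!d i && e) t := by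
    intro e
    have hl : ∀ z, leftPart d (Function.update z i e) =
        Function.update (leftPart d z) i (d i && e) := by
      intro z; ext j; by_cases h : j = i
      · subst h; simp [leftPart]
      · simp [leftPart, h]
    have hr : ∀ z, rightPart d (Function.update z i e) =
        Function.update (rightPart d z) i (!d i && e) := by
      intro z; ext j; by_cases h : j = i
      · subst h; simp [rightPart]
      · simp [rightPart, h]
    simp only [hl, hr, fiberCount]
  simp only [key, Bool.and_true, Bool.and_false]

/-- The disjointness bound: a function with rectangular fibers and few values, some of which
certify an intersection, certifies few of the planted intersections. -/
theorem sum_accept_le {T : (ι → Bool) → (ι → Bool) → τ}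
    (hrect : ∀ a b a' b', T a b = T a' b' → T a b' = T a b)
    {K : Finset τ} (hK : ∀ a b, T a b ∈ K) (acc : τ → Prop) [DecidablePred acc]
    (hacc : ∀ a b, (∀ i, ¬ (a i = true ∧ b i = true)) → ¬ acc (T a b)) :
    ∑ i, ∑ d : ι → Bool, (#{z | acc (T (Function.update (leftPart d z) i true)
        (Function.update (rightPart d z) i true))} : ℝ) ≤
      16 * (2 ^ Fintype.card ι * 2 ^ Fintype.card ι) * Real.log #K := by
  -- The two parts of `z` have disjoint supports, so without the planted pair the inputs are
  -- disjoint.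
  have hdisj : ∀ d i t, acc t → fiberCount T d i false false t = 0 := by
    intro d i t ht
    rw [fiberCount, card_eq_zero, filter_eq_empty_iff]
    rintro z _ rfl
    refine hacc _ _ ?_ ht
    intro j
    by_cases h : j = i
    · subst h; simp
    · cases hd : d j <;> simp [leftPart, rightPart, h, hd]
  have hstep : ∀ i d, (#{z | acc (T (Function.update (leftPart d z) i true)
        (Function.update (rightPart d z) i true))} : ℝ) ≤
      2 * (hellingerAt T K (Function.update d i true) i +
        hellingerAt T K (Function.update d i false) i) := by
    intro i d
    set n := fun a b t => (fiberCount T d i a b t : ℝ) with hn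
    have hn0 : ∀ a b t, 0 ≤ n a b t := fun a b t => by positivity
    have hsum : ∀ a b, ∑ t ∈ K, n a b t = 2 ^ Fintype.card ι := sum_fiberCount hK d i
    have hA : (#{z | acc (T (Function.update (leftPart d z) i true)
        (Function.update (rightPart d z) i true))} : ℝ) = ∑ t ∈ K with acc t, n true true t := by
      have := card_eq_sum_card_fiberwise
        (f := fun z => T (Function.update (leftPart d z) i true)
          (Function.update (rightPart d z) i true))
        (s := ({z | acc (T (Function.update (leftPart d z) i true)
          (Function.update (rightPart d z) i true))} : Finset (ι → Bool)))
        (t := K.filter acc) (fun z hz => by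
          simp only [coe_filter, mem_univ, true_and, Set.mem_ofPred_eq] at hz ⊢
          exact ⟨hK _ _, hz⟩)
      rw [this]
      push_cast
      refine sum_congr rfl fun t ht => ?_
      simp only [hn, fiberCount, filter_filter]
      norm_cast
      congr 1
      ext z
      simp only [mem_filter, mem_univ, true_and, and_iff_right_iff_imp]
      rintro rfl
      exact (mem_filter.1 ht).2
    have hexpand : ∀ a b : ℝ, 0 ≤ a → 0 ≤ b → (√a - √b) ^ 2 = a + b - 2 * √(a * b) := by
      intro a b ha hb
      rw [sub_sq, Real.sq_sqrt ha, Real.sq_sqrt hb, Real.sqrt_mul ha]; ring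
    rw [hA]
    calc ∑ t ∈ K with acc t, n true true t
        = ∑ t ∈ K with acc t, (√(n true true t) - √(n false false t)) ^ 2 := by
          refine sum_congr rfl fun t ht => ?_
          have : n false false t = 0 := by
            simp only [hn]; exact_mod_cast hdisj d i t (mem_filter.1 ht).2
          rw [this]; simp [Real.sq_sqrt (hn0 true true t)]
      _ ≤ ∑ t ∈ K, (√(n true true t) - √(n false false t)) ^ 2 :=
          sum_le_sum_of_subset_of_nonneg (filter_subset _ _) fun _ _ _ => sq_nonneg _
      -- All four laws have the same total mass, so the distance depends only on the sum of `√(a *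
      -- b)`, which cut and paste preserves.
      _ = ∑ t ∈ K, (√(n true false t) - √(n false true t)) ^ 2 := by
          have hprod : ∀ t, n true true t * n false false t = n true false t * n false true t := by
            intro t
            have := fiberCount_cut_paste hrect d i t
            simp only [hn]
            rw [mul_comm, mul_comm (fiberCount T d i true false t : ℝ)]
            exact_mod_cast this
          simp only [hexpand _ _ (hn0 _ _ _) (hn0 _ _ _), hprod, sum_sub_distrib,
            sum_add_distrib, hsum]
      _ ≤ ∑ t ∈ K, (2 * (√(n true false t) - √(n false false t)) ^ 2 +
            2 * (√(n false true t) - √(n false false t)) ^ 2) := by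
          refine sum_le_sum fun t _ => ?_
          nlinarith [sq_nonneg (√(n true false t) - √(n false false t) +
            (√(n false true t) - √(n false false t)))]
      _ = _ := by
          simp only [hellingerAt, Function.update_self, fiberCount_update, Bool.not_true,
            Bool.not_false, sum_add_distrib, ← mul_sum, hn]
          ring
  -- Forcing `d i = e` reaches each such `d` twice. The sum over both `e` is then twice the sum over
  -- all `d`.
  have hflip : ∀ i (e : Bool), ∑ d : ι → Bool, hellingerAt T K (Function.update d i e) i =
      2 * ∑ d : ι → Bool with d i = e, hellingerAt T K d i := by
    intro i e
    rw [← sum_filter_add_sum_filter_not univ (fun d : ι → Bool => d i = e), two_mul]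
    congr 1
    · refine sum_congr rfl fun d hd => ?_
      rw [← (mem_filter.1 hd).2, Function.update_eq_self]
    · refine sum_bij' (fun d _ => Function.update d i e) (fun d _ => Function.update d i (!e))
        ?_ ?_ ?_ ?_ ?_
      · intro d hd; simp
      · intro d hd; simp
      · intro d hd
        have : (!e) = d i := by
          have := (mem_filter.1 hd).2
          cases e <;> cases h : d i <;> simp_all
        simp [this]
      · intro d hd
        have := (mem_filter.1 hd).2
        simp [← this]
      · intro d hd; rfl
  have hsumflip : ∀ i, ∑ d : ι → Bool, (hellingerAt T K (Function.update d i true) i +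
        hellingerAt T K (Function.update d i false) i) =
      2 * ∑ d : ι → Bool, hellingerAt T K d i := by
    intro i
    rw [sum_add_distrib, hflip, hflip, ← mul_add]
    congr 1
    rw [← sum_filter_add_sum_filter_not univ (fun d : ι → Bool => d i = true)]
    simp only [Bool.not_eq_true]
  calc _ ≤ ∑ i, ∑ d : ι → Bool, 2 * (hellingerAt T K (Function.update d i true) i +
        hellingerAt T K (Function.update d i false) i) :=
        sum_le_sum fun i _ => sum_le_sum fun d _ => hstep i d
    _ = 4 * ∑ d : ι → Bool, ∑ i, hellingerAt T K d i := by
        rw [sum_comm (s := (univ : Finset (ι → Bool))), mul_sum]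
        refine sum_congr rfl fun i _ => ?_
        rw [← mul_sum, hsumflip]; ring
    _ ≤ 4 * ∑ _d : ι → Bool, 4 * 2 ^ Fintype.card ι * Real.log #K := by
        gcongr with d
        exact sum_hellingerAt_le hK d
    _ = _ := by
        rw [sum_const, card_univ, Fintype.card_fun, Fintype.card_bool, nsmul_eq_mul]
        push_cast; ring

end Disjointness

/-! ### Simulating the queries: transcripts enlarged by local information. -/

section Transcript

/-- The transcript of a local computation that also records what has to be known about each
query for it to be answered. -/
def QueryComp.record {n : ℕ} {β : Type} (rec : ℝ → List Bool)
    (br : Set.Icc (0 : ℝ) 1 → Finset (Fin n)) : QueryComp n β → List Bool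
  | .done _ => [false]
  | .ask α next => true :: (rec α ++ (next (br α)).record rec br)

/-- The transcript of a protocol that also records what has to be known about each query, and
about the output, for it to be answered. -/
def Protocol.record {n : ℕ} (rec : ℝ → List Bool)
    (br : Set.Icc (0 : ℝ) 1 → Finset (Fin n)) (f c : SetFun n) :
    Protocol n → (Party → List (Finset (Fin n))) → List Bool
  | .output p out, mem =>
    (out (partyInput f c p) (mem p)).record rec br ++
      rec ((out (partyInput f c p) (mem p)).run br).1
  | .send p msg next, mem =>
    (msg (partyInput f c p) (mem p)).record rec br ++
      (((msg (partyInput f c p) (mem p)).run br).1 ::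
        (next ((msg (partyInput f c p) (mem p)).run br).1).record rec br f c
          (Function.update mem p (mem p ++ ((msg (partyInput f c p) (mem p)).run br).2)))

/-- The part of the two inputs that decides the answer to a query: an index and the two bits of
the parties at this index. -/
def localBits {ι : Type} (enc : ι → List Bool) (k : ℝ → ι) (a b : ι → Bool) (α : ℝ) : List Bool :=
  enc (k α) ++ [a (k α), b (k α)]

variable {n L : ℕ} {ι : Type} {enc : ι → List Bool} {k : ℝ → ι}

theorem QueryComp.length_record {β : Type} {rec : ℝ → List Bool} {l : ℕ}
    (hrec : ∀ α, (rec α).length = l) (br : Set.Icc (0 : ℝ) 1 → Finset (Fin n))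
    (c : QueryComp n β) : (c.record rec br).length = (l + 1) * (c.run br).2.length + 1 := by
  induction c with
  | done x => simp [record, run]
  | ask α next ih =>
    simp only [record, run, List.length_cons, List.length_append, hrec, ih]
    ring

/-- Each bit sent costs two, itself and the marker `false` that ends the local computation. Each
query costs its block and the marker `true`, and the last `l + 1` are the final marker and the block
of the output. -/
theorem Protocol.length_record {rec : ℝ → List Bool} {l : ℕ}
    (hrec : ∀ α, (rec α).length = l) (br : Set.Icc (0 : ℝ) 1 → Finset (Fin n))
    (f c : SetFun n) (P : Protocol n) (mem : Party → List (Finset (Fin n))) :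
    (P.record rec br f c mem).length =
      2 * (P.exec br f c mem).bits + (l + 1) * (P.exec br f c mem).queries + (l + 1) := by
  induction P generalizing mem with
  | output p out =>
    simp only [record, exec, List.length_append, hrec, QueryComp.length_record hrec]
    ring
  | send p msg next ih =>
    simp only [record, exec, List.length_append, List.length_cons, ih,
      QueryComp.length_record hrec]
    ring

theorem localBits_append_inj (henc : ∀ i j, (enc i).length = (enc j).length)
    (hinj : Function.Injective enc) {a b a' b' : ι → Bool} {α α' : ℝ} {l l' : List Bool}
    (h : localBits enc k a b α ++ l = localBits enc k a' b' α' ++ l') :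
    k α = k α' ∧ a (k α) = a' (k α) ∧ b (k α) = b' (k α) ∧ l = l' := by
  simp only [localBits, List.append_assoc] at h
  obtain ⟨h1, h2⟩ := List.append_inj h (henc _ _)
  have hk := hinj h1
  simp only [List.cons_append, List.nil_append, List.cons.injEq] at h2
  rw [← hk] at h2
  exact ⟨hk, h2.1, h2.2.1, h2.2.2⟩

/-- If two local computations have the same record, then the first one runs in the same way on any
inputs that agree with its own inputs wherever the two pairs of inputs agree. -/
theorem QueryComp.record_mixed {β : Type} (henc : ∀ i j, (enc i).length = (enc j).length)
    (hinj : Function.Injective enc)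
    {br : (ι → Bool) → (ι → Bool) → Set.Icc (0 : ℝ) 1 → Finset (Fin n)}
    (hbr : ∀ a b a' b' α, a (k α) = a' (k α) → b (k α) = b' (k α) → br a b α = br a' b' α)
    {a b a' b' a'' b'' : ι → Bool}
    (hmix : ∀ i, a i = a' i → b i = b' i → a'' i = a i ∧ b'' i = b i)
    (c c' : QueryComp n β) (l l' : List Bool)
    (h : c.record (localBits enc k a b) (br a b) ++ l =
      c'.record (localBits enc k a' b') (br a' b') ++ l') :
    l = l' ∧ c.record (localBits enc k a'' b'') (br a'' b'') =
        c.record (localBits enc k a b) (br a b) ∧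
      c.run (br a'' b'') = c.run (br a b) := by
  induction c generalizing c' with
  | done x =>
    cases c' with
    | done x' => simpa [record, run] using h
    | ask α' next' => simp [record] at h
  | ask α next ih =>
    cases c' with
    | done x' => simp [record] at h
    | ask α' next' =>
      simp only [record, List.cons_append, List.append_assoc, List.cons.injEq, true_and] at h
      obtain ⟨hk, ha, hb, hl⟩ := localBits_append_inj henc hinj h
      obtain ⟨ha'', hb''⟩ := hmix _ ha hb
      have hans : br a'' b'' α = br a b α := hbr _ _ _ _ _ ha'' hb''
      obtain ⟨h1, h2, h3⟩ := ih _ _ hl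
      refine ⟨h1, ?_, ?_⟩
      · simp only [record, hans, h2, localBits, ha'', hb'']
      · simp only [run, hans, h3]

/-- The records of a protocol have rectangular fibers. -/
theorem Protocol.record_rectangle (henc : ∀ i j, (enc i).length = (enc j).length)
    (hinj : Function.Injective enc) (f c : (ι → Bool) → SetFun n)
    {br : (ι → Bool) → (ι → Bool) → Set.Icc (0 : ℝ) 1 → Finset (Fin n)}
    (hbr : ∀ a b a' b' α, a (k α) = a' (k α) → b (k α) = b' (k α) → br a b α = br a' b' α)
    {a b a' b' : ι → Bool} (P : Protocol n) (mem mem' mem'' : Party → List (Finset (Fin n)))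
    (hmemA : mem'' .alice = mem .alice) (hmemB : mem'' .bob = mem' .bob)
    (h : P.record (localBits enc k a b) (br a b) (f a) (c b) mem =
      P.record (localBits enc k a' b') (br a' b') (f a') (c b') mem') :
    P.record (localBits enc k a b') (br a b') (f a) (c b') mem'' =
      P.record (localBits enc k a b) (br a b) (f a) (c b) mem := by
  -- On the mixed inputs Alice's computations follow the first run and Bob's follow the second, so
  -- the comparison is needed in both orders.
  have hmix1 : ∀ i, a i = a' i → b i = b' i → a i = a i ∧ b' i = b i :=
    fun i _ hb => ⟨rfl, hb.symm⟩
  have hmix2 : ∀ i, a' i = a i → b' i = b i → a i = a' i ∧ b' i = b' i :=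
    fun i ha _ => ⟨ha.symm, rfl⟩
  -- The block of the output: the contract is that of the first run if Alice outputs it, and that of
  -- the second if Bob does.
  have hend : ∀ α α' : ℝ, localBits enc k a b α = localBits enc k a' b' α' →
      localBits enc k a b' α = localBits enc k a b α ∧
      localBits enc k a b' α' = localBits enc k a b α := by
    intro α α' h
    obtain ⟨h1, h2, h3, -⟩ := localBits_append_inj (l := []) (l' := []) henc hinj
      (by simpa using h)
    constructor
    · simp only [localBits, h3]
    · simp only [localBits, ← h1, h3]
  induction P generalizing mem mem' mem'' with
  | output p out =>
    cases p with
    | alice =>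
      simp only [record, partyInput] at h ⊢
      obtain ⟨h1, h2, h3⟩ := QueryComp.record_mixed henc hinj hbr hmix1 _ _ _ _ h
      rw [hmemA, h2, h3, (hend _ _ h1).1]
    | bob =>
      simp only [record, partyInput] at h ⊢
      obtain ⟨h1, h2, h3⟩ := QueryComp.record_mixed henc hinj hbr hmix2 _ _ _ _ h.symm
      rw [hmemB, h2, h3, (hend _ _ h1.symm).2]
      rw [h1] at h
      exact congrArg (· ++ _) (List.append_cancel_right h).symm
  | send p msg next ih =>
    cases p with
    | alice =>
      simp only [record, partyInput] at h ⊢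
      obtain ⟨h1, h2, h3⟩ := QueryComp.record_mixed henc hinj hbr hmix1 _ _ _ _ h
      simp only [List.cons.injEq] at h1
      rw [hmemA, h2, h3]
      rw [← h1.1] at h1
      congr 2
      exact ih _ _ _ _ (by simp) (by simp [hmemB]) h1.2
    | bob =>
      simp only [record, partyInput] at h ⊢
      obtain ⟨h1, h2, h3⟩ := QueryComp.record_mixed henc hinj hbr hmix2 _ _ _ _ h.symm
      rw [hmemB, h2, h3]
      rw [h1] at h
      have h4 := List.append_cancel_right h
      simp only [List.cons.injEq] at h1
      rw [h4, h1.1]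
      rw [h1.1] at h1
      congr 2
      exact ih _ _ _ _ (by simp [hmemA]) (by simp) h1.2.symm

theorem Protocol.suffix_record {rec : ℝ → List Bool}
    (br : Set.Icc (0 : ℝ) 1 → Finset (Fin n)) (f c : SetFun n) (P : Protocol n)
    (mem : Party → List (Finset (Fin n))) :
    rec (P.exec br f c mem).contract <:+ P.record rec br f c mem := by
  induction P generalizing mem with
  | output p out => exact List.suffix_append _ _
  | send p msg next ih =>
    exact ((ih _ _).trans (List.suffix_cons _ _)).trans (List.suffix_append _ _)

/-- Whether the output points to an intersection is readable from the record alone, which makes it a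
property of the class. -/
theorem suffix_localBits_iff {a b : ι → Bool} {α : ℝ} {l : List Bool}
    (h : localBits enc k a b α <:+ l) :
    [true, true] <:+ l ↔ a (k α) = true ∧ b (k α) = true := by
  obtain ⟨t, rfl⟩ := h
  constructor
  · rintro ⟨s, hs⟩
    simp only [localBits, ← List.append_assoc] at hs
    have := (List.append_inj' hs rfl).2
    simp only [List.cons.injEq] at this
    exact ⟨this.1.symm, this.2.1.symm⟩
  · rintro ⟨h1, h2⟩
    refine ⟨t ++ enc (k α), ?_⟩
    simp [localBits, h1, h2]

/-- The bit strings of length at most `B`. -/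
def boolLists (B : ℕ) : Finset (List Bool) :=
  (Finset.range (B + 1)).biUnion fun r =>
    (Finset.univ : Finset (Fin r → Bool)).image List.ofFn

theorem mem_boolLists {B : ℕ} {l : List Bool} (h : l.length ≤ B) : l ∈ boolLists B := by
  simp only [boolLists, Finset.mem_biUnion, Finset.mem_range, Finset.mem_image, Finset.mem_univ,
    true_and]
  exact ⟨l.length, by omega, l.get, List.ofFn_get l⟩

theorem card_boolLists_le (B : ℕ) : (boolLists B).card ≤ 2 ^ (B + 1) := by
  refine Finset.card_biUnion_le.trans ?_
  calc _ ≤ ∑ r ∈ Finset.range (B + 1), 2 ^ r :=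
        Finset.sum_le_sum fun r _ => Finset.card_image_le.trans (by simp)
    _ ≤ 2 ^ (B + 1) := (Nat.geomSum_lt le_rfl (fun r hr => Finset.mem_range.1 hr)).le

end Transcript

/-! ### Perturbations of symmetric set functions. -/

section LevelFunctions

variable {n : ℕ} {L : ℕ → ℝ} {r : Finset (Fin n) → ℝ} {B : ℝ}

/-- A set function that depends only on the size, and increases fast enough, stays monotone under
a small perturbation. -/
theorem monotone_level_add (hr : ∀ S, |r S| ≤ B)
    (hd : ∀ l, l < n → 2 * B ≤ L (l + 1) - L l) :
    Monotone fun S : Finset (Fin n) => L #S + r S := by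
  have hB : 0 ≤ B := (abs_nonneg _).trans (hr ∅)
  have hlt : ∀ k l, k + 1 ≤ l → l ≤ n → L k + 2 * B ≤ L l := by
    intro k l hkl
    induction l, hkl using Nat.le_induction with
    | base => intro h; linarith [hd k h]
    | succ l _ ih => intro h; linarith [ih (by omega), hd l h]
  intro S T hST
  rcases eq_or_ne S T with rfl | hne
  · exact le_rfl
  have hcard := card_lt_card (hST.ssubset_of_ne hne)
  have hT : #T ≤ n := by simpa using card_le_univ T
  have := hlt _ _ hcard hT
  have h1 := abs_le.1 (hr S)
  have h2 := abs_le.1 (hr T)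
  simp only
  linarith

/-- A set function that depends only on the size, and is concave enough, stays submodular under
a small perturbation. -/
theorem isSubmodular_level_add (hr : ∀ S, |r S| ≤ B)
    (hdd : ∀ l, l + 1 < n → L (l + 2) - L (l + 1) + 4 * B ≤ L (l + 1) - L l) :
    IsSubmodular fun S : Finset (Fin n) => L #S + r S := by
  have hB : 0 ≤ B := (abs_nonneg _).trans (hr ∅)
  -- A perturbation changes each of the two marginals by at most `2 * B`. A proper inclusion gives a
  -- gap of at least one level.
  have hlt : ∀ k l, k + 1 ≤ l → l < n → L (l + 1) - L l + 4 * B ≤ L (k + 1) - L k := by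
    intro k l hkl
    induction l, hkl using Nat.le_induction with
    | base => intro h; exact hdd k h
    | succ l _ ih => intro h; linarith [ih (by omega), hdd l h]
  intro S T hST i hi
  rcases eq_or_ne S T with rfl | hne
  · exact le_rfl
  have hcard := card_lt_card (hST.ssubset_of_ne hne)
  have hT : #T < n := by
    have := card_le_univ (insert i T)
    rw [card_insert_of_notMem hi] at this
    simpa using this
  have := hlt _ _ hcard hT
  simp only [card_insert_of_notMem hi, card_insert_of_notMem fun h => hi (hST h)]
  have h1 := abs_le.1 (hr S)
  have h2 := abs_le.1 (hr T)
  have h3 := abs_le.1 (hr (insert i S))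
  have h4 := abs_le.1 (hr (insert i T))
  linarith

theorem hasBits_div {b N : ℕ} {z : ℤ} (hN : 0 < N) (hz : |z| ≤ N) (hb : N < 2 ^ b) :
    HasBits b ((z : ℝ) / N) := by
  refine ⟨(z : ℚ) / (N : ℤ), by push_cast; rfl, ?_, ?_⟩
  · have hle : ((z : ℚ) / (N : ℤ)).num.natAbs ≤ N := by
      rcases eq_or_ne z 0 with rfl | h0
      · simp
      · have h1 := Nat.le_of_dvd (Int.natAbs_pos.2 h0)
          (Int.natAbs_dvd_natAbs.2 (Rat.num_dvd z (b := (N : ℤ)) (by exact_mod_cast hN.ne')))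
        rw [Rat.divInt_eq_div] at h1
        rw [Int.abs_eq_natAbs] at hz
        omega
    omega
  · have h1 : (((z : ℚ) / (N : ℤ)).den : ℤ) ∣ N := by
      have := Rat.den_dvd z (N : ℤ)
      rwa [Rat.divInt_eq_div] at this
    have h2 := Nat.le_of_dvd hN (Int.natCast_dvd_natCast.1 h1)
    omega

theorem isBestResponse_div_iff {f c : SetFun n} {D : ℝ} (hD : 0 < D) (α : ℝ)
    (S : Finset (Fin n)) :
    IsBestResponse (fun S => f S / D) (fun S => c S / D) α S ↔ IsBestResponse f c α S := by
  have h : ∀ T, α * (f T / D) - c T / D = (α * f T - c T) / D := fun T => by ring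
  simp only [IsBestResponse, h, div_le_div_iff_of_pos_right hD, div_left_inj' hD.ne']

end LevelFunctions

/-! ### The hard instance and the locality of its best responses. -/

section HardInstance

/-- The size of the perturbed sets. -/
def midLevel (n : ℕ) : ℕ := n / 2

/-- The weight of the symmetric part. -/
def weight (n : ℕ) : ℕ := 64 * 4 ^ n

/-- The reward of the middle level, before normalization. -/
def midReward (n : ℕ) : ℕ := 2 * weight n * midLevel n * (4 * n - midLevel n)

/-- The normalization factor. -/
def normalizer (n : ℕ) : ℕ := 16 * weight n * n ^ 2

/-- The symmetric part of the reward. -/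
noncomputable def rewardLevel (n l : ℕ) : ℝ :=
  if l ≤ midLevel n then 2 * weight n * l * (4 * n - l)
  else midReward n + weight n * (l - midLevel n) * (2 * n - l - midLevel n)

/-- The symmetric part of the cost. -/
noncomputable def costLevel (n l : ℕ) : ℝ :=
  weight n * l * (4 * n + midLevel n - 2 * l)

/-- A bit as a real number. -/
noncomputable def bitVal (b : Bool) : ℝ := if b then 1 else 0

/-- The reward before normalization: the set number `j` of the middle level has an additional
reward of `j`, and a little more if the bit `p j` is set. -/
noncomputable def rawReward (n : ℕ) (idx : Finset (Fin n) → ℕ) (p : ℕ → Bool) : SetFun n :=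
  fun S => rewardLevel n #S +
    if #S = midLevel n then idx S + bitVal (p (idx S)) / (16 * midReward n) else 0

/-- The cost before normalization. -/
noncomputable def rawCost (n : ℕ) (idx : Finset (Fin n) → ℕ) (q : ℕ → Bool) : SetFun n :=
  fun S => costLevel n #S +
    if #S = midLevel n then (idx S : ℝ) / 2 + idx S * (idx S + 1) / (4 * midReward n) -
      bitVal (q (idx S)) / (16 * midReward n) else 0

/-- The reward function of the hard instance. -/
noncomputable def hardReward (n : ℕ) (idx : Finset (Fin n) → ℕ) (p : ℕ → Bool) : SetFun n :=
  fun S => rawReward n idx p S / normalizer n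

/-- The cost function of the hard instance. -/
noncomputable def hardCost (n : ℕ) (idx : Finset (Fin n) → ℕ) (q : ℕ → Bool) : SetFun n :=
  fun S => rawCost n idx q S / normalizer n

/-- `idx` numbers the sets of the middle level by `0, …, M - 1`. -/
structure IsIndexing (n M : ℕ) (idx : Finset (Fin n) → ℕ) : Prop where
  lt : ∀ S, #S = midLevel n → idx S < M
  surj : ∀ j < M, ∃ S, #S = midLevel n ∧ idx S = j
  inj : ∀ S T, #S = midLevel n → #T = midLevel n → idx S = idx T → S = T

theorem bitVal_nonneg (b : Bool) : 0 ≤ bitVal b := by cases b <;> simp [bitVal]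

theorem bitVal_le_one (b : Bool) : bitVal b ≤ 1 := by cases b <;> simp [bitVal]

variable {n M : ℕ} {idx : Finset (Fin n) → ℕ} {p q : ℕ → Bool}

theorem cast_midReward (n : ℕ) :
    (midReward n : ℝ) = 2 * weight n * midLevel n * (4 * n - midLevel n) := by
  have : midLevel n ≤ 4 * n := by unfold midLevel; omega
  simp only [midReward]
  push_cast [Nat.cast_sub this]
  ring

theorem midLevel_bounds (hn : 2 ≤ n) : (1 : ℝ) ≤ midLevel n ∧ 2 * (midLevel n : ℝ) ≤ n := by
  constructor
  · exact_mod_cast (by unfold midLevel; omega : 1 ≤ midLevel n)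
  · exact_mod_cast (by unfold midLevel; omega : 2 * midLevel n ≤ n)

/-- The weight beats `M ^ 2`, not just `M`: this also makes the quadratic term of the cost and the
loss `j ^ 2` in the principal's utility negligible. -/
theorem weight_bounds (hM : M ≤ 2 ^ n) : 64 * (M : ℝ) ^ 2 ≤ weight n ∧ 64 ≤ (weight n : ℝ) := by
  constructor
  · have h : M ^ 2 ≤ 4 ^ n := by
      calc M ^ 2 ≤ (2 ^ n) ^ 2 := Nat.pow_le_pow_left hM 2
        _ = 4 ^ n := by rw [← pow_mul, mul_comm, pow_mul]; norm_num
    have h' : 64 * M ^ 2 ≤ weight n := by unfold weight; omega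
    exact_mod_cast h'
  · have h : 64 ≤ weight n := by unfold weight; have := Nat.one_le_pow n 4 (by norm_num); omega
    exact_mod_cast h

theorem weight_le_midReward (hn : 2 ≤ n) : (weight n : ℝ) ≤ midReward n := by
  obtain ⟨h1, h2⟩ := midLevel_bounds hn
  rw [cast_midReward]
  have hw : (0 : ℝ) ≤ weight n := by positivity
  have : (1 : ℝ) ≤ midLevel n * (4 * n - midLevel n) := by nlinarith
  nlinarith

theorem rewardLevel_mid (n : ℕ) : rewardLevel n (midLevel n) = midReward n := by
  rw [rewardLevel, if_pos le_rfl, cast_midReward]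

theorem costLevel_mid (n : ℕ) : costLevel n (midLevel n) = midReward n / 2 := by
  rw [costLevel, cast_midReward]; ring

theorem rewardLevel_diff (n l : ℕ) : rewardLevel n (l + 1) - rewardLevel n l =
    if l < midLevel n then 2 * (weight n : ℝ) * (4 * n - 2 * l - 1)
    else (weight n : ℝ) * (2 * n - 2 * l - 1) := by
  rcases lt_trichotomy l (midLevel n) with h | h | h
  · rw [rewardLevel, rewardLevel, if_pos (by omega), if_pos (by omega), if_pos h]
    push_cast; ring
  · subst h
    rw [rewardLevel_mid, rewardLevel, if_neg (by omega), if_neg (by omega)]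
    push_cast; ring
  · rw [rewardLevel, rewardLevel, if_neg (by omega), if_neg (by omega), if_neg (by omega)]
    push_cast; ring

theorem costLevel_diff (n l : ℕ) : costLevel n (l + 1) - costLevel n l =
    weight n * (4 * n + midLevel n - 4 * l - 2) := by
  rw [costLevel, costLevel]; push_cast; ring

theorem rewardLevel_increasing {l : ℕ} (h : l < n) :
    (weight n : ℝ) ≤ rewardLevel n (l + 1) - rewardLevel n l := by
  rw [rewardLevel_diff]
  have hw : (0 : ℝ) ≤ weight n := by positivity
  have hl : (l : ℝ) + 1 ≤ n := by exact_mod_cast h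
  split_ifs <;> nlinarith

theorem rewardLevel_concave {l : ℕ} (h : l + 1 < n) :
    rewardLevel n (l + 2) - rewardLevel n (l + 1) + weight n ≤
      rewardLevel n (l + 1) - rewardLevel n l := by
  rw [rewardLevel_diff, rewardLevel_diff]
  have hw : (0 : ℝ) ≤ weight n := by positivity
  have hl : (l : ℝ) + 2 ≤ n := by exact_mod_cast h
  push_cast
  split_ifs <;> nlinarith

theorem costLevel_increasing {l : ℕ} (hn : 2 ≤ n) (h : l < n) :
    (weight n : ℝ) ≤ costLevel n (l + 1) - costLevel n l := by
  rw [costLevel_diff]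
  have hw : (0 : ℝ) ≤ weight n := by positivity
  have hl : (l : ℝ) + 1 ≤ n := by exact_mod_cast h
  have := (midLevel_bounds hn).1
  nlinarith

theorem costLevel_concave (l : ℕ) :
    costLevel n (l + 2) - costLevel n (l + 1) + weight n ≤
      costLevel n (l + 1) - costLevel n l := by
  rw [costLevel_diff, costLevel_diff]
  have hw : (0 : ℝ) ≤ weight n := by positivity
  push_cast
  nlinarith

theorem bitVal_div_le (hn : 2 ≤ n) (b : Bool) :
    0 ≤ bitVal b / (16 * midReward n) ∧ bitVal b / (16 * midReward n) ≤ 1 / 1024 := by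
  have hX := weight_le_midReward hn
  have hW := (weight_bounds (M := 0) (n := n) (by simp)).2
  have h0 := bitVal_nonneg b
  have h1 := bitVal_le_one b
  refine ⟨by positivity, ?_⟩
  rw [div_le_div_iff₀ (by linarith) (by norm_num)]
  linarith

theorem abs_rewardPert_le (hn : 2 ≤ n) (hM : M ≤ 2 ^ n) (hidx : IsIndexing n M idx)
    (S : Finset (Fin n)) :
    |if #S = midLevel n then (idx S : ℝ) + bitVal (p (idx S)) / (16 * midReward n) else 0| ≤
      (weight n : ℝ) / 4 := by
  have hW := weight_bounds hM
  split_ifs with h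
  · have hj : (idx S : ℝ) + 1 ≤ M := by exact_mod_cast hidx.lt S h
    have hb := bitVal_div_le hn (p (idx S))
    have hj0 : (0 : ℝ) ≤ idx S := by positivity
    rw [abs_le]
    constructor <;> nlinarith
  · rw [abs_zero]; positivity

theorem costPert_bounds (hn : 2 ≤ n) (hM : M ≤ 2 ^ n) (hidx : IsIndexing n M idx)
    (S : Finset (Fin n)) (h : #S = midLevel n) :
    0 ≤ (idx S : ℝ) * (idx S + 1) / (4 * midReward n) ∧
      (idx S : ℝ) * (idx S + 1) / (4 * midReward n) ≤ 1 := by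
  have hW := weight_bounds hM
  have hX := weight_le_midReward hn
  have hj : (idx S : ℝ) + 1 ≤ M := by exact_mod_cast hidx.lt S h
  have hj0 : (0 : ℝ) ≤ idx S := by positivity
  refine ⟨by positivity, ?_⟩
  rw [div_le_one (by linarith)]
  nlinarith

theorem abs_costPert_le (hn : 2 ≤ n) (hM : M ≤ 2 ^ n) (hidx : IsIndexing n M idx)
    (S : Finset (Fin n)) :
    |if #S = midLevel n then (idx S : ℝ) / 2 + idx S * (idx S + 1) / (4 * midReward n) -
      bitVal (q (idx S)) / (16 * midReward n) else 0| ≤ (weight n : ℝ) / 4 := by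
  have hW := weight_bounds hM
  split_ifs with h
  · have hj : (idx S : ℝ) + 1 ≤ M := by exact_mod_cast hidx.lt S h
    have hb := bitVal_div_le hn (q (idx S))
    have hc := costPert_bounds hn hM hidx S h
    have hj0 : (0 : ℝ) ≤ idx S := by positivity
    rw [abs_le]
    constructor <;> nlinarith
  · rw [abs_zero]; positivity

theorem rewardLevel_le {l : ℕ} (hn : 2 ≤ n) (hl : l ≤ n) :
    0 ≤ rewardLevel n l ∧ rewardLevel n l ≤ 15 * weight n * n ^ 2 := by
  obtain ⟨hm1, hm2⟩ := midLevel_bounds hn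
  have hw : (0 : ℝ) ≤ weight n := by positivity
  have hl' : (l : ℝ) ≤ n := by exact_mod_cast hl
  have hl0 : (0 : ℝ) ≤ l := by positivity
  have key : ∃ y : ℝ, rewardLevel n l = weight n * y ∧ 0 ≤ y ∧ y ≤ 15 * n ^ 2 := by
    unfold rewardLevel
    split_ifs with h
    · exact ⟨2 * (l * (4 * n - l)), by ring, by nlinarith, by nlinarith⟩
    · have hml : (midLevel n : ℝ) ≤ l := by exact_mod_cast (by omega : midLevel n ≤ l)
      refine ⟨2 * midLevel n * (4 * n - midLevel n) +
        (l - midLevel n) * (2 * n - l - midLevel n), by rw [cast_midReward]; ring, ?_, ?_⟩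
      · have h1 : 0 ≤ (l - midLevel n : ℝ) * (2 * n - l - midLevel n) :=
          mul_nonneg (by linarith) (by linarith)
        nlinarith
      · nlinarith
  obtain ⟨y, hy, hy0, hy1⟩ := key
  rw [hy]
  exact ⟨by positivity, by nlinarith⟩

theorem costLevel_le {l : ℕ} (hn : 2 ≤ n) (hl : l ≤ n) :
    0 ≤ costLevel n l ∧ costLevel n l ≤ 15 * weight n * n ^ 2 := by
  obtain ⟨hm1, hm2⟩ := midLevel_bounds hn
  have hw : (0 : ℝ) ≤ weight n := by positivity
  have hl' : (l : ℝ) ≤ n := by exact_mod_cast hl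
  have hl0 : (0 : ℝ) ≤ l := by positivity
  have h0 : 0 ≤ (l : ℝ) * (4 * n + midLevel n - 2 * l) := mul_nonneg hl0 (by linarith)
  have h1 : (l : ℝ) * (4 * n + midLevel n - 2 * l) ≤ 15 * n ^ 2 := by nlinarith
  rw [costLevel, mul_assoc]
  exact ⟨by positivity, by nlinarith⟩

theorem cast_normalizer (n : ℕ) : (normalizer n : ℝ) = 16 * weight n * n ^ 2 := by
  simp [normalizer]

theorem rawReward_bounds (hn : 2 ≤ n) (hM : M ≤ 2 ^ n) (hidx : IsIndexing n M idx)
    (S : Finset (Fin n)) : 0 ≤ rawReward n idx p S ∧ rawReward n idx p S ≤ normalizer n := by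
  have h1 := rewardLevel_le hn (by simpa using card_le_univ S : #S ≤ n)
  have h2 := (abs_le.1 (abs_rewardPert_le (p := p) hn hM hidx S)).2
  have hw : (0 : ℝ) ≤ weight n := by positivity
  have hn' : (2 : ℝ) ≤ n := by exact_mod_cast hn
  rw [cast_normalizer, rawReward]
  constructor
  · refine add_nonneg h1.1 ?_
    split_ifs
    · exact add_nonneg (by positivity) (bitVal_div_le hn _).1
    · exact le_rfl
  · have : (weight n : ℝ) * 1 ≤ weight n * n ^ 2 := by gcongr; nlinarith
    linarith

theorem rawCost_bounds (hn : 2 ≤ n) (hM : M ≤ 2 ^ n) (hidx : IsIndexing n M idx)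
    (hq : ∀ j, q (2 * j) = false)
    (S : Finset (Fin n)) : 0 ≤ rawCost n idx q S ∧ rawCost n idx q S ≤ normalizer n := by
  have h1 := costLevel_le hn (by simpa using card_le_univ S : #S ≤ n)
  have h2 := (abs_le.1 (abs_costPert_le (q := q) hn hM hidx S)).2
  have hw : (0 : ℝ) ≤ weight n := by positivity
  have hn' : (2 : ℝ) ≤ n := by exact_mod_cast hn
  rw [cast_normalizer, rawCost]
  constructor
  · refine add_nonneg h1.1 ?_
    split_ifs with h
    · have hc := costPert_bounds hn hM hidx S h
      -- Bob's bit lowers the cost, but number 0 carries no bit, and for the others `idx S / 2`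
      -- outweighs it.
      rcases Nat.eq_zero_or_pos (idx S) with h0 | h0
      · have := hq 0
        simp only [mul_zero] at this
        simp [h0, this, bitVal]
      · have hj : (1 : ℝ) ≤ idx S := by exact_mod_cast h0
        have := (bitVal_div_le hn (q (idx S))).2
        linarith
    · exact le_rfl
  · have : (weight n : ℝ) * 1 ≤ weight n * n ^ 2 := by gcongr; nlinarith
    linarith

theorem normalizer_pos (hn : 2 ≤ n) : 0 < normalizer n := by
  unfold normalizer weight; positivity

theorem midReward_pos (hn : 2 ≤ n) : 0 < midReward n := by
  have h1 := weight_le_midReward hn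
  have h2 := (weight_bounds (M := 0) (n := n) (by simp)).2
  exact_mod_cast (by linarith : (0 : ℝ) < midReward n)

theorem rewardLevel_int (n l : ℕ) : ∃ z : ℤ, rewardLevel n l = z := by
  unfold rewardLevel
  split_ifs
  · exact ⟨2 * weight n * l * (4 * n - l), by push_cast; ring⟩
  · exact ⟨midReward n + weight n * (l - midLevel n) * (2 * n - l - midLevel n),
      by push_cast; ring⟩

theorem costLevel_int (n l : ℕ) : ∃ z : ℤ, costLevel n l = z :=
  ⟨weight n * l * (4 * n + midLevel n - 2 * l), by unfold costLevel; push_cast; ring⟩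

theorem bitVal_int (b : Bool) : ∃ z : ℤ, bitVal b = z :=
  ⟨if b then 1 else 0, by cases b <;> simp [bitVal]⟩

theorem rawReward_int (hn : 2 ≤ n) (S : Finset (Fin n)) :
    ∃ z : ℤ, rawReward n idx p S = z / (16 * midReward n : ℕ) := by
  have hX : (0 : ℝ) < midReward n := by exact_mod_cast midReward_pos hn
  obtain ⟨z, hz⟩ := rewardLevel_int n #S
  obtain ⟨y, hy⟩ := bitVal_int (p (idx S))
  rw [rawReward, hz, hy]
  split_ifs
  · exact ⟨(z + idx S) * (16 * midReward n) + y, by push_cast; field_simp; ring⟩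
  · exact ⟨z * (16 * midReward n), by push_cast; field_simp; ring⟩

theorem rawCost_int (hn : 2 ≤ n) (S : Finset (Fin n)) :
    ∃ z : ℤ, rawCost n idx q S = z / (16 * midReward n : ℕ) := by
  have hX : (0 : ℝ) < midReward n := by exact_mod_cast midReward_pos hn
  obtain ⟨z, hz⟩ := costLevel_int n #S
  obtain ⟨y, hy⟩ := bitVal_int (q (idx S))
  rw [rawCost, hz, hy]
  split_ifs
  · exact ⟨z * (16 * midReward n) + 8 * idx S * midReward n + 4 * idx S * (idx S + 1) - y,
      by push_cast; field_simp; ring⟩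
  · exact ⟨z * (16 * midReward n), by push_cast; field_simp; ring⟩

/-- All values share the denominator `16 * midReward n * normalizer n`, which is below `2 ^ (8 * n +
23)`. -/
theorem hasBits_div_normalizer (hn : 2 ≤ n) {x : ℝ} (hx : 0 ≤ x) (hx1 : x ≤ normalizer n)
    (hz : ∃ z : ℤ, x = z / (16 * midReward n : ℕ)) :
    HasBits (8 * n + 24) (x / normalizer n) := by
  obtain ⟨z, rfl⟩ := hz
  have hX := midReward_pos hn
  have hD := normalizer_pos hn
  have hX' : (0 : ℝ) < (16 * midReward n : ℕ) := by exact_mod_cast (by omega)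
  rw [div_div, ← Nat.cast_mul]
  refine hasBits_div (by positivity) ?_ ?_
  · have h0 : (0 : ℝ) ≤ z := by
      have := mul_nonneg hx hX'.le
      rwa [div_mul_cancel₀ _ hX'.ne'] at this
    rw [abs_of_nonneg (by exact_mod_cast h0)]
    rw [div_le_iff₀ hX', mul_comm] at hx1
    exact_mod_cast hx1
  · have hn2 : n < 2 ^ n := Nat.lt_two_pow_self
    have hm : midReward n ≤ 8 * weight n * n ^ 2 := by
      have h1 : midLevel n ≤ n := by unfold midLevel; omega
      calc midReward n ≤ 2 * weight n * n * (4 * n) := by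
            unfold midReward; gcongr; omega
        _ = _ := by ring
    calc 16 * midReward n * normalizer n
        ≤ 16 * (8 * weight n * n ^ 2) * (16 * weight n * n ^ 2) := by
          unfold normalizer; gcongr
      _ = 2 ^ 11 * weight n ^ 2 * n ^ 4 := by ring
      _ < 2 ^ 11 * weight n ^ 2 * (2 ^ n) ^ 4 := by
          have : 0 < weight n := by unfold weight; positivity
          gcongr
      _ = 2 ^ (8 * n + 23) := by
          have : (4 : ℕ) ^ n = 2 ^ (2 * n) := by rw [pow_mul]; norm_num
          unfold weight; rw [this]; ring
      _ ≤ 2 ^ (8 * n + 24) := Nat.pow_le_pow_right (by norm_num) (by omega)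

theorem isInstance_hard (hn : 2 ≤ n) (hM : M ≤ 2 ^ n) (hidx : IsIndexing n M idx)
    (hq : ∀ j, q (2 * j) = false) :
    IsInstance n (8 * n + 24) (hardReward n idx p) (hardCost n idx q) := by
  have hD : (0 : ℝ) < normalizer n := by exact_mod_cast normalizer_pos hn
  have hf := rawReward_bounds (p := p) hn hM hidx
  have hc := rawCost_bounds hn hM hidx hq
  have hw : (0 : ℝ) ≤ weight n := by positivity
  have hsub : ∀ v : SetFun n, IsSubmodular v → IsSubmodular fun S => v S / normalizer n := by
    intro v hv S T hST i hi
    simp only [← sub_div]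
    exact div_le_div_of_nonneg_right (hv S T hST i hi) hD.le
  have hmono : ∀ v : SetFun n, Monotone v → Monotone fun S => v S / normalizer n :=
    fun v hv S T hST => div_le_div_of_nonneg_right (hv hST) hD.le
  refine ⟨fun S => ⟨div_nonneg (hf S).1 hD.le, (div_le_one hD).2 (hf S).2⟩,
    fun S => div_nonneg (hc S).1 hD.le, hmono _ ?_, hmono _ ?_, hsub _ ?_, hsub _ ?_,
    fun S => hasBits_div_normalizer hn (hf S).1 (hf S).2 (rawReward_int hn S),
    fun S => hasBits_div_normalizer hn (hc S).1 (hc S).2 (rawCost_int hn S)⟩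
  · exact monotone_level_add (abs_rewardPert_le hn hM hidx) fun l hl => by
      linarith [rewardLevel_increasing hl]
  · exact monotone_level_add (abs_costPert_le hn hM hidx) fun l hl => by
      linarith [costLevel_increasing hn hl]
  · exact isSubmodular_level_add (abs_rewardPert_le hn hM hidx) fun l hl => by
      linarith [rewardLevel_concave hl]
  · exact isSubmodular_level_add (abs_costPert_le hn hM hidx) fun l hl => by
      linarith [costLevel_concave (n := n) l]

/-- The position of a contract on the scale on which the set number `j` replaces the set number
`j - 1` at about `j`. -/
noncomputable def position (n : ℕ) (α : ℝ) : ℝ := (2 * α - 1) * midReward n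

theorem rawReward_mid {S : Finset (Fin n)} (hS : #S = midLevel n) :
    rawReward n idx p S = midReward n + idx S + bitVal (p (idx S)) / (16 * midReward n) := by
  rw [rawReward, if_pos hS, hS, rewardLevel_mid]; ring

/-- Up to the bits, the part that depends on `j = idx S` is `2 s j - j (j + 1)`, so `j` overtakes `j
- 1` exactly at `s = j`. -/
theorem utility_mid (hn : 2 ≤ n) {S : Finset (Fin n)} (hS : #S = midLevel n) (α : ℝ) :
    4 * midReward n * (α * rawReward n idx p S - rawCost n idx q S) =
      2 * position n α * (midReward n + idx S) - idx S ^ 2 - idx S +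
        (α * bitVal (p (idx S)) + bitVal (q (idx S))) / 4 := by
  have hX : (0 : ℝ) < midReward n := by exact_mod_cast midReward_pos hn
  rw [rawReward_mid hS, rawCost, if_pos hS, hS, costLevel_mid, position]
  field_simp
  ring

theorem utility_empty (hn : 2 ≤ n) (α : ℝ) :
    α * rawReward n idx p ∅ - rawCost n idx q ∅ = 0 := by
  have : ¬ 0 = midLevel n := by unfold midLevel; omega
  simp [rawReward, rawCost, rewardLevel, costLevel, this]

/-- The two alternatives are losing to the empty set and losing to the middle set number 0. Below
the middle level `costLevel - rewardLevel / 2` is `weight n * l * (midLevel n - l)`, which vanishes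
only at the two ends, so a smaller set loses to the empty set for `α < 1 / 2` and to the middle
otherwise. Above it the slope of the reward drops, and the added cost exceeds the added reward even
at `α = 1`. -/
theorem utility_off_level (hn : 2 ≤ n) {α : ℝ} (h1 : α ≤ 1) {S : Finset (Fin n)}
    (hne : S ≠ ∅) (hS : #S ≠ midLevel n) :
    α * rawReward n idx p S - rawCost n idx q S < 0 ∨
      4 * midReward n * (α * rawReward n idx p S - rawCost n idx q S) <
        2 * position n α * midReward n := by
  obtain ⟨hm1, hm2⟩ := midLevel_bounds hn
  have hX : (0 : ℝ) < midReward n := by exact_mod_cast midReward_pos hn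
  have hW : (0 : ℝ) < weight n := by
    linarith [(weight_bounds (M := 0) (n := n) (by simp)).2]
  have hl0 : (1 : ℝ) ≤ #S := by exact_mod_cast card_pos.2 (nonempty_iff_ne_empty.2 hne)
  have hln : (#S : ℝ) ≤ n := by exact_mod_cast (by simpa using card_le_univ S : #S ≤ n)
  simp only [rawReward, rawCost, if_neg hS, add_zero]
  suffices h : (rewardLevel n #S ≤ midReward n ∧ rewardLevel n #S / 2 < costLevel n #S) ∨
      (midReward n ≤ rewardLevel n #S ∧
        rewardLevel n #S - midReward n < costLevel n #S - midReward n / 2) by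
    set F := rewardLevel n #S
    set C := costLevel n #S
    have key : α * F - C < 0 ∨ α * F - C < α * midReward n - midReward n / 2 := by
      rcases h with ⟨h2, h3⟩ | ⟨h2, h3⟩
      · by_cases hα : α < 1 / 2
        · left
          have hF : 0 ≤ F := (rewardLevel_le hn (by exact_mod_cast hln)).1
          nlinarith
        · right; push Not at hα; nlinarith
      · right; nlinarith
    refine key.imp_right fun h => ?_
    rw [position]
    nlinarith
  rcases lt_or_gt_of_ne hS with h | h
  · left
    have hlm : (#S : ℝ) + 1 ≤ midLevel n := by exact_mod_cast h
    rw [rewardLevel, if_pos h.le, costLevel, cast_midReward]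
    constructor
    · have : (#S : ℝ) * (4 * n - #S) ≤ midLevel n * (4 * n - midLevel n) := by nlinarith
      nlinarith
    · have : (0 : ℝ) < #S * (midLevel n - #S) := mul_pos (by linarith) (by linarith)
      nlinarith
  · right
    have hlm : (midLevel n : ℝ) + 1 ≤ #S := by exact_mod_cast h
    rw [rewardLevel, if_neg (by omega), costLevel]
    constructor
    · have : (0 : ℝ) ≤ (#S - midLevel n) * (2 * n - #S - midLevel n) :=
        mul_nonneg (by linarith) (by linarith)
      nlinarith
    · have h2 : (0 : ℝ) < (#S - midLevel n) * (2 * n - #S) := mul_pos (by linarith) (by linarith)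
      have h3 := mul_pos hW h2
      rw [cast_midReward]
      nlinarith

theorem pert_bounds {α : ℝ} (h0 : 0 ≤ α) (h1 : α ≤ 1) (b b' : Bool) :
    0 ≤ α * bitVal b + bitVal b' ∧ α * bitVal b + bitVal b' ≤ 2 := by
  cases b <;> cases b' <;> simp [bitVal] <;> constructor <;> linarith

/-- Besides the empty set, only sets of the middle level are best responses, and only to contracts
from `1 / 2` on. -/
theorem bestResponse_cases (hn : 2 ≤ n) (hidx : IsIndexing n M idx) (hM0 : 0 < M)
    (hp : ∀ j, p (2 * j) = false) (hq : ∀ j, q (2 * j) = false)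
    {α : ℝ} (h0 : 0 ≤ α) (h1 : α ≤ 1) {S : Finset (Fin n)}
    (h : IsBestResponse (rawReward n idx p) (rawCost n idx q) α S) :
    S = ∅ ∨ #S = midLevel n ∧ 0 ≤ position n α := by
  have hX : (0 : ℝ) < midReward n := by exact_mod_cast midReward_pos hn
  have hempty := h.1 ∅
  rw [utility_empty hn] at hempty
  have hp0 : p 0 = false := hp 0
  have hq0 : q 0 = false := hq 0
  by_cases hne : S = ∅
  · exact Or.inl hne
  right
  by_cases hS : #S = midLevel n
  · refine ⟨hS, ?_⟩
    by_contra! hs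
    have hu := utility_mid (idx := idx) (p := p) (q := q) hn hS α
    have hneg : 2 * position n α * (midReward n + idx S) < 0 := by
      have : (0 : ℝ) < midReward n + idx S := by positivity
      nlinarith
    have hpos : 0 ≤ 4 * midReward n * (α * rawReward n idx p S - rawCost n idx q S) := by
      positivity
    rcases Nat.eq_zero_or_pos (idx S) with hj | hj
    · rw [hj] at hu hneg
      simp only [hp0, hq0, bitVal] at hu
      norm_num at hu hneg
      linarith
    · have hj' : (1 : ℝ) ≤ idx S := by exact_mod_cast hj
      have := pert_bounds h0 h1 (p (idx S)) (q (idx S))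
      nlinarith
  · exfalso
    obtain ⟨S₀, hS₀, hi⟩ := hidx.surj 0 hM0
    have h3 := h.1 S₀
    have hu := utility_mid (idx := idx) (p := p) (q := q) hn hS₀ α
    rw [hi] at hu
    simp only [hp0, hq0, bitVal] at hu
    norm_num at hu
    rcases utility_off_level (idx := idx) (p := p) (q := q) hn h1 hne hS with h2 | h2
    · linarith
    · nlinarith

theorem bestResponse_position_le (hn : 2 ≤ n) {α : ℝ}
    {S T : Finset (Fin n)} (hS : #S = midLevel n) (hT : #T = midLevel n)
    (h : IsBestResponse (rawReward n idx p) (rawCost n idx q) α S) :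
    2 * position n α * idx T - idx T ^ 2 - idx T +
        (α * bitVal (p (idx T)) + bitVal (q (idx T))) / 4 ≤
      2 * position n α * idx S - idx S ^ 2 - idx S +
        (α * bitVal (p (idx S)) + bitVal (q (idx S))) / 4 := by
  have hX : (0 : ℝ) < midReward n := by exact_mod_cast midReward_pos hn
  have h1 := utility_mid (idx := idx) (p := p) (q := q) hn hS α
  have h2 := utility_mid (idx := idx) (p := p) (q := q) hn hT α
  have h3 : 4 * midReward n * (α * rawReward n idx p T - rawCost n idx q T) ≤
      4 * midReward n * (α * rawReward n idx p S - rawCost n idx q S) :=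
    mul_le_mul_of_nonneg_left (h.1 T) (by positivity)
  rw [h1, h2] at h3
  linarith

/-- Comparison with the preceding set. For contracts in `[0, 1]` the bits move the threshold `i + 1`
by at most `1 / 4`. -/
theorem position_ge_of_bestResponse (hn : 2 ≤ n) (hidx : IsIndexing n M idx) {α : ℝ}
    {S : Finset (Fin n)} (hS : #S = midLevel n)
    (h : IsBestResponse (rawReward n idx p) (rawCost n idx q) α S) {i : ℕ} (hi : idx S = i + 1) :
    2 * ((i : ℝ) + 1) + (α * bitVal (p i) + bitVal (q i)) / 4 -
      (α * bitVal (p (i + 1)) + bitVal (q (i + 1))) / 4 ≤ 2 * position n α := by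
  obtain ⟨T, hT, hTi⟩ := hidx.surj i (by have := hidx.lt S hS; omega)
  have := bestResponse_position_le hn hS hT h
  rw [hTi, hi] at this
  push_cast at this
  linarith

theorem position_le_of_bestResponse (hn : 2 ≤ n) (hidx : IsIndexing n M idx) {α : ℝ}
    {S : Finset (Fin n)} (hS : #S = midLevel n)
    (h : IsBestResponse (rawReward n idx p) (rawCost n idx q) α S) {i : ℕ} (hi : idx S = i)
    (hiM : i + 1 < M) :
    2 * position n α ≤ 2 * ((i : ℝ) + 1) + (α * bitVal (p i) + bitVal (q i)) / 4 -
      (α * bitVal (p (i + 1)) + bitVal (q (i + 1))) / 4 := by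
  obtain ⟨T, hT, hTi⟩ := hidx.surj (i + 1) hiM
  have := bestResponse_position_le hn hS hT h
  rw [hTi, hi] at this
  push_cast at this
  linarith

/-- The only pair of bits that can have an influence on the best response to `α` is the one with
this index. -/
noncomputable def bitIndex (n N : ℕ) (α : ℝ) : ℕ :=
  min ⌊(position n α - 1 / 2) / 2⌋₊ (N - 1)

/-- A response numbered `j` forces the position into `[j - 1 / 4, j + 5 / 4]`, apart from the ends
of the numbering. For `j = 2 * k + 1`, halving after the shift by `1 / 2` lands strictly between `k`
and `k + 1`; for even `j` it may land on either side, whence three candidates, of which only the odd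
one carries bits. -/
theorem idx_bestResponse (hn : 2 ≤ n) (hidx : IsIndexing n M idx) (hM : 2 ≤ M)
    {α : ℝ} (h0 : 0 ≤ α) (h1 : α ≤ 1) {S : Finset (Fin n)} (hS : #S = midLevel n)
    (h : IsBestResponse (rawReward n idx p) (rawCost n idx q) α S) :
    2 * bitIndex n (M / 2) α ≤ idx S ∧ idx S ≤ 2 * bitIndex n (M / 2) α + 2 := by
  have hlt := hidx.lt S hS
  set s := position n α with hs
  have hlow : idx S = 0 ∨ (idx S : ℝ) ≤ s + 1 / 4 := by
    rcases Nat.eq_zero_or_pos (idx S) with hj | hj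
    · exact Or.inl hj
    · right
      obtain ⟨i, hi⟩ : ∃ i, idx S = i + 1 := ⟨idx S - 1, by omega⟩
      have := position_ge_of_bestResponse hn hidx hS h hi
      have hb := pert_bounds h0 h1 (p i) (q i)
      have hb' := pert_bounds h0 h1 (p (i + 1)) (q (i + 1))
      rw [hi]; push_cast; linarith
  have hup : idx S + 1 = M ∨ s ≤ idx S + 5 / 4 := by
    by_cases hj : idx S + 1 = M
    · exact Or.inl hj
    · right
      have := position_le_of_bestResponse hn hidx hS h rfl (by omega)
      have hb := pert_bounds h0 h1 (p (idx S)) (q (idx S))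
      have hb' := pert_bounds h0 h1 (p (idx S + 1)) (q (idx S + 1))
      linarith
  rw [bitIndex, ← hs]
  set k := ⌊(s - 1 / 2) / 2⌋₊ with hk
  have hk1 : (s - 1 / 2) / 2 < k + 1 := Nat.lt_floor_add_one _
  have hk2 : k = 0 ∨ (k : ℝ) ≤ (s - 1 / 2) / 2 := by
    rcases Nat.eq_zero_or_pos k with h | h
    · exact Or.inl h
    · exact Or.inr ((Nat.floor_pos.1 h |> fun h' => Nat.floor_le (by linarith)))
  have hA : 2 * k ≤ idx S ∨ idx S + 1 = M := by
    rcases hup with h | h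
    · exact Or.inr h
    · left
      rcases hk2 with h2 | h2
      · omega
      · have : (2 * k : ℝ) < idx S + 1 := by linarith
        have : 2 * k < idx S + 1 := by exact_mod_cast this
        omega
  have hB : idx S ≤ 2 * k + 2 := by
    rcases hlow with h | h
    · omega
    · have : (idx S : ℝ) < 2 * k + 3 := by linarith
      have : idx S < 2 * k + 3 := by exact_mod_cast this
      omega
  omega

/-- The numbers differ by integers and the bits contribute less than 1. Hence tie-breaking by the
reward leaves a single best response, and the oracle has no freedom on these instances. -/
theorem rawReward_injOn (hn : 2 ≤ n) (hidx : IsIndexing n M idx) {S T : Finset (Fin n)}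
    (hS : #S = midLevel n) (hT : #T = midLevel n)
    (h : rawReward n idx p S = rawReward n idx p T) : S = T := by
  refine hidx.inj S T hS hT ?_
  rw [rawReward_mid hS, rawReward_mid hT] at h
  have h1 := bitVal_div_le hn (p (idx S))
  have h2 := bitVal_div_le hn (p (idx T))
  have h3 : (idx S : ℝ) < idx T + 1 := by linarith
  have h4 : (idx T : ℝ) < idx S + 1 := by linarith
  have h3' : idx S < idx T + 1 := by exact_mod_cast h3
  have h4' : idx T < idx S + 1 := by exact_mod_cast h4
  omega

/-- The best response to `α` depends only on the two bits with index `bitIndex n (M / 2) α`. -/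
theorem bestResponse_eq (hn : 2 ≤ n) (hidx : IsIndexing n M idx) (hM : 2 ≤ M)
    {p' q' : ℕ → Bool}
    (hp : ∀ j, p (2 * j) = false) (hq : ∀ j, q (2 * j) = false)
    (hp' : ∀ j, p' (2 * j) = false) (hq' : ∀ j, q' (2 * j) = false)
    {α : ℝ} (h0 : 0 ≤ α) (h1 : α ≤ 1)
    (hpp : p (2 * bitIndex n (M / 2) α + 1) = p' (2 * bitIndex n (M / 2) α + 1))
    (hqq : q (2 * bitIndex n (M / 2) α + 1) = q' (2 * bitIndex n (M / 2) α + 1))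
    {S T : Finset (Fin n)}
    (hS : IsBestResponse (rawReward n idx p) (rawCost n idx q) α S)
    (hT : IsBestResponse (rawReward n idx p') (rawCost n idx q') α T) : S = T := by
  have hloc : ∀ {V : Finset (Fin n)}, V = ∅ ∨ #V = midLevel n ∧
      2 * bitIndex n (M / 2) α ≤ idx V ∧ idx V ≤ 2 * bitIndex n (M / 2) α + 2 →
      rawReward n idx p V = rawReward n idx p' V ∧ rawCost n idx q V = rawCost n idx q' V := by
    intro V hV
    have hb : #V = midLevel n → p (idx V) = p' (idx V) ∧ q (idx V) = q' (idx V) := by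
      intro hVm
      rcases hV with rfl | ⟨-, h2, h3⟩
      · have : ¬ 0 = midLevel n := by unfold midLevel; omega
        exact absurd (by simpa using hVm) this
      · obtain h | h | h : idx V = 2 * bitIndex n (M / 2) α ∨
            idx V = 2 * bitIndex n (M / 2) α + 1 ∨ idx V = 2 * (bitIndex n (M / 2) α + 1) := by
          omega
        · rw [h, hp, hq, hp', hq']; exact ⟨rfl, rfl⟩
        · rw [h]; exact ⟨hpp, hqq⟩
        · rw [h, hp, hq, hp', hq']; exact ⟨rfl, rfl⟩
    simp only [rawReward, rawCost]
    split_ifs with hVm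
    · rw [(hb hVm).1, (hb hVm).2]; exact ⟨rfl, rfl⟩
    · exact ⟨rfl, rfl⟩
  have hSc := bestResponse_cases hn hidx (by omega) hp hq h0 h1 hS
  have hTc := bestResponse_cases hn hidx (by omega) hp' hq' h0 h1 hT
  -- Each of the two sets has the same reward and cost in both instances, so each can be tested
  -- against the other in either one.
  have hS' := hloc (hSc.imp_right fun h => ⟨h.1, idx_bestResponse hn hidx hM h0 h1 h.1 hS⟩)
  have hT' := hloc (hTc.imp_right fun h => ⟨h.1, idx_bestResponse hn hidx hM h0 h1 h.1 hT⟩)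
  have hu1 := hS.1 T
  have hu2 := hT.1 S
  rw [← hS'.1, ← hS'.2, ← hT'.1, ← hT'.2] at hu2
  have hu := le_antisymm hu1 hu2
  have hf1 := hS.2 T hu
  have hf2 := hT.2 S (by rw [← hS'.1, ← hS'.2, ← hT'.1, ← hT'.2, hu])
  rw [← hS'.1, ← hT'.1] at hf2
  have hf := le_antisymm hf2 hf1
  have hX : (0 : ℝ) < midReward n := by exact_mod_cast midReward_pos hn
  have hempty : rawReward n idx p ∅ = 0 := by
    have : ¬ 0 = midLevel n := by unfold midLevel; omega
    simp [rawReward, rewardLevel, this]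
  have hpos : ∀ V : Finset (Fin n), #V = midLevel n → 0 < rawReward n idx p V := by
    intro V hV
    rw [rawReward_mid hV]
    have := (bitVal_div_le hn (p (idx V))).1
    positivity
  rcases hSc with rfl | ⟨hSm, -⟩
  · rcases hTc with rfl | ⟨hTm, -⟩
    · rfl
    · have := hpos T hTm; linarith
  · rcases hTc with rfl | ⟨hTm, -⟩
    · have := hpos S hSm; linarith
    · exact rawReward_injOn hn hidx hSm hTm hf

end HardInstance

/-! ### An optimal contract points to an intersection. -/

section OptimalContract

variable {n M : ℕ} {idx : Finset (Fin n) → ℕ} {p q : ℕ → Bool}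

theorem odd_of_bit {j : ℕ} (hp : ∀ j, p (2 * j) = false) (h : p j = true) : ∃ k, j = 2 * k + 1 := by
  refine ⟨j / 2, ?_⟩
  by_contra hj
  have h2 : j = 2 * (j / 2) := by omega
  rw [h2, hp] at h
  exact absurd h (by simp)

/-- The set number `j`, with both of its bits set, is a best response at the position
`j - 3 / 16`. -/
theorem isBestResponse_of_bits (hn : 2 ≤ n) (hidx : IsIndexing n M idx)
    (hp : ∀ j, p (2 * j) = false) (hq : ∀ j, q (2 * j) = false)
    {α : ℝ} (h0 : 1 / 2 ≤ α) (h1 : α ≤ 1) {S : Finset (Fin n)} (hS : #S = midLevel n)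
    (hpS : p (idx S) = true) (hqS : q (idx S) = true)
    (hpos : position n α = idx S - 3 / 16) :
    IsBestResponse (rawReward n idx p) (rawCost n idx q) α S := by
  have hX : (0 : ℝ) < midReward n := by exact_mod_cast midReward_pos hn
  obtain ⟨k, hk⟩ := odd_of_bit hp hpS
  have hj : (1 : ℝ) ≤ idx S := by exact_mod_cast (by omega : 1 ≤ idx S)
  have hu := utility_mid (idx := idx) (p := p) (q := q) hn hS α
  rw [hpS, hqS, hpos] at hu
  simp only [bitVal, if_true] at hu
  have hbase : 2 * position n α * midReward n ≤
      4 * midReward n * (α * rawReward n idx p S - rawCost n idx q S) := by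
    rw [hu, hpos]
    have : (0 : ℝ) ≤ (idx S - 1) * (idx S - 3 / 8) := mul_nonneg (by linarith) (by linarith)
    nlinarith
  have hpos0 : 0 < 2 * position n α * midReward n := by
    rw [hpos]; exact mul_pos (by linarith) hX
  have hu0 : 0 < α * rawReward n idx p S - rawCost n idx q S := by
    have := hpos0.trans_le hbase
    exact (mul_pos_iff_of_pos_left (by positivity)).1 this
  have hmid : ∀ T, #T = midLevel n → T ≠ S →
      (α * rawReward n idx p T - rawCost n idx q T <
        α * rawReward n idx p S - rawCost n idx q S) ∨
      (α * rawReward n idx p T - rawCost n idx q T ≤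
        α * rawReward n idx p S - rawCost n idx q S) ∧ idx T < idx S := by
    intro T hT hne
    have hv := utility_mid (idx := idx) (p := p) (q := q) hn hT α
    rw [hpos] at hv
    have hb := pert_bounds (by linarith) h1 (p (idx T)) (q (idx T))
    have hi0 : (0 : ℝ) ≤ idx T := by positivity
    obtain h | h | h | h : idx T = idx S ∨ idx T + 1 = idx S ∨ idx T + 2 ≤ idx S ∨
        idx S + 1 ≤ idx T := by omega
    · exact absurd (hidx.inj T S hT hS h) hne
    -- With both bits the threshold against the predecessor, which has none, is `j - (α + 1) / 8`.
    -- The offset `3 / 16` is its value at `α = 1 / 2`; a tie there goes to `S`, whose reward is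
    -- higher.
    · right
      refine ⟨?_, by omega⟩
      have hTk : idx T = 2 * k := by omega
      have hr : (idx S : ℝ) = idx T + 1 := by exact_mod_cast h.symm
      rw [hTk, hp, hq, ← hTk] at hv
      simp only [bitVal] at hv
      norm_num at hv
      have : 4 * midReward n * (α * rawReward n idx p T - rawCost n idx q T) ≤
          4 * midReward n * (α * rawReward n idx p S - rawCost n idx q S) := by
        rw [hu, hv, hr]; nlinarith
      exact le_of_mul_le_mul_left this (by positivity)
    · left
      have hr : (idx T : ℝ) + 2 ≤ idx S := by exact_mod_cast h
      have : 4 * midReward n * (α * rawReward n idx p T - rawCost n idx q T) <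
          4 * midReward n * (α * rawReward n idx p S - rawCost n idx q S) := by
        rw [hu, hv]
        have : (0 : ℝ) ≤ (idx S - idx T - 2) * (idx S - idx T + 5 / 8) :=
          mul_nonneg (by linarith) (by linarith)
        nlinarith
      exact lt_of_mul_lt_mul_left this (by positivity)
    · left
      have hr : (idx S : ℝ) + 1 ≤ idx T := by exact_mod_cast h
      have : 4 * midReward n * (α * rawReward n idx p T - rawCost n idx q T) <
          4 * midReward n * (α * rawReward n idx p S - rawCost n idx q S) := by
        rw [hu, hv]
        have : (0 : ℝ) ≤ (idx T - idx S - 1) * (idx T - idx S + 19 / 8) :=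
          mul_nonneg (by linarith) (by linarith)
        nlinarith
      exact lt_of_mul_lt_mul_left this (by positivity)
  have hother : ∀ T, #T ≠ midLevel n →
      α * rawReward n idx p T - rawCost n idx q T <
        α * rawReward n idx p S - rawCost n idx q S := by
    intro T hT
    by_cases hne : T = ∅
    · rw [hne, utility_empty hn]; exact hu0
    · rcases utility_off_level (idx := idx) (p := p) (q := q) hn h1 hne hT with h | h
      · linarith
      · exact lt_of_mul_lt_mul_left (h.trans_le hbase) (by positivity)
  constructor
  · intro T
    by_cases hT : #T = midLevel n
    · by_cases hTS : T = S
      · rw [hTS]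
      · rcases hmid T hT hTS with h | h
        · exact h.le
        · exact h.1
    · exact (hother T hT).le
  · intro T heq
    by_cases hT : #T = midLevel n
    · by_cases hTS : T = S
      · rw [hTS]
      · rcases hmid T hT hTS with h | h
        · exact absurd heq h.ne
        · rw [rawReward_mid hT, rawReward_mid hS]
          have h3 := (bitVal_div_le hn (p (idx T))).2
          have h4 := (bitVal_div_le hn (p (idx S))).1
          have h5 : (idx T : ℝ) + 1 ≤ idx S := by exact_mod_cast h.2
          linarith
    · exact absurd heq (hother T hT).ne

/-- If some set has both bits set, then an optimal contract reveals such a set. -/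
theorem bits_of_isOptimalContract (hn : 2 ≤ n) (hidx : IsIndexing n M idx) (hM : 2 ≤ M)
    (hM2 : M ≤ 2 ^ n) (hp : ∀ j, p (2 * j) = false) (hq : ∀ j, q (2 * j) = false)
    {j : ℕ} (hjM : j < M) (hpj : p j = true) (hqj : q j = true) {α : ℝ}
    (hα : IsOptimalContract (hardReward n idx p) (hardCost n idx q) α) :
    p (2 * bitIndex n (M / 2) α + 1) = true ∧ q (2 * bitIndex n (M / 2) α + 1) = true := by
  have hX : (0 : ℝ) < midReward n := by exact_mod_cast midReward_pos hn
  have hD : (0 : ℝ) < normalizer n := by exact_mod_cast normalizer_pos hn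
  have hXM : 64 * (M : ℝ) ^ 2 ≤ midReward n :=
    (weight_bounds hM2).1.trans (weight_le_midReward hn)
  have hMr : (2 : ℝ) ≤ M := by exact_mod_cast hM
  obtain ⟨⟨h0, h1⟩, S, hS, hopt⟩ := hα
  replace hS : IsBestResponse (rawReward n idx p) (rawCost n idx q) α S :=
    (isBestResponse_div_iff hD α S).1 hS
  obtain ⟨T, hT, hTj⟩ := hidx.surj j hjM
  obtain ⟨k, hk⟩ := odd_of_bit hp hpj
  have hj1 : (1 : ℝ) ≤ j := by exact_mod_cast (by omega : 1 ≤ j)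
  have hjM' : (j : ℝ) ≤ M := by exact_mod_cast hjM.le
  set β : ℝ := 1 / 2 + (j - 3 / 16) / (2 * midReward n) with hβ
  have hβpos : position n β = j - 3 / 16 := by
    rw [position, hβ]; field_simp; ring
  have hβ0 : 1 / 2 ≤ β := by
    have : 0 ≤ (j - 3 / 16) / (2 * midReward n : ℝ) := div_nonneg (by linarith) (by positivity)
    linarith
  have hβ1 : β ≤ 1 := by
    have : (j - 3 / 16) / (2 * midReward n : ℝ) ≤ 1 / 2 := by
      rw [div_le_div_iff₀ (by positivity) (by norm_num)]; nlinarith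
    linarith
  have hTbr : IsBestResponse (hardReward n idx p) (hardCost n idx q) β T :=
    (isBestResponse_div_iff hD β T).2 (isBestResponse_of_bits hn hidx hp hq hβ0 hβ1 hT
      (by rw [hTj]; exact hpj) (by rw [hTj]; exact hqj) (by rw [hTj]; exact hβpos))
  have hcmp := hopt β ⟨by linarith, hβ1⟩ T hTbr
  simp only [hardReward, ← mul_div_assoc] at hcmp
  rw [div_le_div_iff_of_pos_right hD, rawReward_mid hT, hTj] at hcmp
  -- Expansion of `(X - j + 3 / 16) * (X + j)`: the terms `X * j` cancel, and the loss `M ^ 2` is at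
  -- most `X / 64`.
  have hlow : (midReward n : ℝ) ^ 2 + 3 / 16 * midReward n - (M : ℝ) ^ 2 ≤
      2 * midReward n * ((1 - α) * rawReward n idx p S) := by
    refine le_trans ?_ (mul_le_mul_of_nonneg_left hcmp (by positivity))
    have h2 : 2 * midReward n * (1 - β) = midReward n - (j - 3 / 16) := by
      rw [hβ]; field_simp; ring
    rw [← mul_assoc, h2]
    have h3 := (bitVal_div_le hn (p j)).1
    have h4 : (0 : ℝ) ≤ midReward n - (j - 3 / 16) := by nlinarith
    have h5 := mul_nonneg h4 h3
    nlinarith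
  have hSc := bestResponse_cases hn hidx (by omega) hp hq h0 h1 hS
  rcases hSc with rfl | ⟨hSm, hs⟩
  · exfalso
    have hempty : rawReward n idx p ∅ = 0 := by
      have : ¬ 0 = midLevel n := by unfold midLevel; omega
      simp [rawReward, rewardLevel, this]
    rw [hempty, mul_zero, mul_zero] at hlow
    nlinarith
  have hbits : p (idx S) = true ∧ q (idx S) = true := by
    by_contra hcon
    -- With a bit missing the threshold moves by at most `1 / 8`, so the utility is at most `X ^ 2 +
    -- X / 8 + 1 / 16`, where the last term is Alice's bit in the reward. This is less than `X ^ 2 +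
    -- 3 * X / 16 - X / 64`.
    have hpert : α * bitVal (p (idx S)) + bitVal (q (idx S)) ≤ 1 := by
      cases hpc : p (idx S) <;> cases hqc : q (idx S) <;> simp_all [bitVal]
    have hgap : (idx S : ℝ) - position n α ≤ 1 / 8 := by
      rcases Nat.eq_zero_or_pos (idx S) with hi | hi
      · rw [hi]; push_cast; linarith
      · obtain ⟨i, hi⟩ : ∃ i, idx S = i + 1 := ⟨idx S - 1, by omega⟩
        have h2 := position_ge_of_bestResponse hn hidx hSm hS hi
        have h3 := (pert_bounds h0 h1 (p i) (q i)).1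
        rw [hi] at hpert
        rw [hi]; push_cast; linarith
    have h2 : 2 * midReward n * (1 - α) = midReward n - position n α := by
      rw [position]; ring
    rw [← mul_assoc, h2, rawReward_mid hSm] at hlow
    set e : ℝ := bitVal (p (idx S)) / (16 * midReward n) with he
    have h3 := (bitVal_div_le hn (p (idx S))).1
    have h4 : midReward n * e ≤ 1 / 16 := by
      have := bitVal_le_one (p (idx S))
      have h5 : midReward n * e = bitVal (p (idx S)) / 16 := by rw [he]; field_simp
      rw [h5]; linarith
    have h6 : 0 ≤ position n α * (idx S + e) := mul_nonneg hs (by positivity)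
    have h7 : (midReward n : ℝ) * (idx S - position n α) ≤ midReward n * (1 / 8) :=
      mul_le_mul_of_nonneg_left hgap hX.le
    nlinarith
  have hrange := idx_bestResponse hn hidx hM h0 h1 hSm hS
  obtain ⟨k', hk'⟩ := odd_of_bit hp hbits.1
  have : idx S = 2 * bitIndex n (M / 2) α + 1 := by omega
  rwa [← this]

end OptimalContract

/-! ### From protocols for contracts to disjointness. -/

section Reduction

/-- The bits of a party, placed at the odd positions. -/
def oddBits {N : ℕ} (a : Fin N → Bool) (j : ℕ) : Bool :=
  if h : j % 2 = 1 ∧ j / 2 < N then a ⟨j / 2, h.2⟩ else false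

theorem oddBits_even {N : ℕ} (a : Fin N → Bool) (j : ℕ) : oddBits a (2 * j) = false := by
  rw [oddBits, dif_neg (by omega)]

theorem oddBits_odd {N : ℕ} (a : Fin N → Bool) (i : Fin N) : oddBits a (2 * i + 1) = a i := by
  have h : (2 * (i : ℕ) + 1) / 2 = i := by omega
  rw [oddBits, dif_pos ⟨by omega, by rw [h]; exact i.2⟩]
  congr 1
  exact Fin.ext h

theorem exists_isIndexing (n : ℕ) : ∃ idx, IsIndexing n (n.choose (midLevel n)) idx := by
  classical
  set s : Finset (Finset (Fin n)) := powersetCard (midLevel n) univ with hs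
  have hcard : #s = n.choose (midLevel n) := by rw [hs, card_powersetCard, card_univ, Fintype.card_fin]
  have hmem : ∀ S, S ∈ s ↔ #S = midLevel n := fun S => by simp [hs, mem_powersetCard]
  refine ⟨fun S => if h : S ∈ s then s.equivFin ⟨S, h⟩ else 0, ⟨?_, ?_, ?_⟩⟩
  · intro S hS
    rw [dif_pos ((hmem S).2 hS), ← hcard]
    exact Fin.is_lt _
  · intro j hj
    rw [← hcard] at hj
    have hS := (s.equivFin.symm ⟨j, hj⟩).2
    refine ⟨s.equivFin.symm ⟨j, hj⟩, (hmem _).1 hS, ?_⟩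
    rw [dif_pos hS]
    simp
  · intro S T hS hT h
    simp only [dif_pos ((hmem S).2 hS), dif_pos ((hmem T).2 hT)] at h
    have := s.equivFin.injective (Fin.ext h)
    simpa using this

/-- The binary code of an index. -/
def binaryCode (n : ℕ) {N : ℕ} (i : Fin N) : List Bool :=
  List.ofFn fun r : Fin n => (i : ℕ).testBit r

theorem binaryCode_injective {n N : ℕ} (hN : N ≤ 2 ^ n) :
    Function.Injective (binaryCode n : Fin N → List Bool) := by
  intro i j h
  have h1 := List.ofFn_injective h
  refine Fin.ext (Nat.eq_of_testBit_eq fun r => ?_)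
  by_cases hr : r < n
  · exact congrFun h1 ⟨r, hr⟩
  · have hle : 2 ^ n ≤ 2 ^ r := Nat.pow_le_pow_right (by norm_num) (by omega)
    rw [Nat.testBit_lt_two_pow (by omega), Nat.testBit_lt_two_pow (by omega)]

/-- A deterministic protocol with few bits and few queries finds the optimal contract only for
few of the planted intersections. -/
theorem sum_card_optimal_le {n M N C Q : ℕ} {idx : Finset (Fin n) → ℕ} (hn : 2 ≤ n)
    (hidx : IsIndexing n M idx) (hM : 2 ≤ M) (hM2 : M ≤ 2 ^ n) (hN : N = M / 2)
    (O : BestResponseOracle n) (P : Protocol n)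
    (hC : ∀ f c, IsInstance n (8 * n + 24) f c → (P.run O f c).bits ≤ C)
    (hQ : ∀ f c, IsInstance n (8 * n + 24) f c → (P.run O f c).queries ≤ Q)
    (good : Fin N → (Fin N → Bool) → (Fin N → Bool) → Prop)
    [∀ i d, DecidablePred (good i d)]
    (hgood : ∀ i d z, good i d z → IsOptimalContract
      (hardReward n idx (oddBits (Function.update (leftPart d z) i true)))
      (hardCost n idx (oddBits (Function.update (rightPart d z) i true)))
      (P.run O (hardReward n idx (oddBits (Function.update (leftPart d z) i true)))
        (hardCost n idx (oddBits (Function.update (rightPart d z) i true)))).contract) :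
    ∑ i, ∑ d : Fin N → Bool, (#{z | good i d z} : ℝ) ≤
      16 * (2 ^ N * 2 ^ N) * ((2 * C + (n + 3) * Q + n + 4 : ℕ) * Real.log 2) := by
  classical
  have hN0 : 0 < N := by omega
  let k : ℝ → Fin N := fun α => ⟨bitIndex n N α, by unfold bitIndex; omega⟩
  let enc : Fin N → List Bool := binaryCode n
  have hlen : ∀ i, (enc i).length = n := fun i => by simp [enc, binaryCode]
  have henc : ∀ i j, (enc i).length = (enc j).length := fun i j => by rw [hlen, hlen]
  have hinj : Function.Injective enc := binaryCode_injective (by omega)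
  let f : (Fin N → Bool) → SetFun n := fun a => hardReward n idx (oddBits a)
  let c : (Fin N → Bool) → SetFun n := fun b => hardCost n idx (oddBits b)
  let br : (Fin N → Bool) → (Fin N → Bool) → Set.Icc (0 : ℝ) 1 → Finset (Fin n) :=
    fun a b => O.answer (f a) (c b)
  have hinst : ∀ a b, IsInstance n (8 * n + 24) (f a) (c b) :=
    fun a b => isInstance_hard hn hM2 hidx (oddBits_even b)
  have hD : (0 : ℝ) < normalizer n := by exact_mod_cast normalizer_pos hn
  have hk : ∀ (a : Fin N → Bool) α, oddBits a (2 * bitIndex n (M / 2) α + 1) = a (k α) := by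
    intro a α
    rw [← hN]; exact oddBits_odd a (k α)
  have hbr : ∀ a b a' b' (α : Set.Icc (0 : ℝ) 1), a (k α) = a' (k α) → b (k α) = b' (k α) →
      br a b α = br a' b' α := by
    intro a b a' b' α ha hb
    refine bestResponse_eq hn hidx hM (oddBits_even a) (oddBits_even b) (oddBits_even a')
      (oddBits_even b') α.2.1 α.2.2 (by rw [hk, hk, ha]) (by rw [hk, hk, hb])
      ((isBestResponse_div_iff hD _ _).1 (O.isBestResponse (f a) (c b) α))
      ((isBestResponse_div_iff hD _ _).1 (O.isBestResponse (f a') (c b') α))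
  let T : (Fin N → Bool) → (Fin N → Bool) → List Bool := fun a b =>
    P.record (localBits enc k a b) (br a b) (f a) (c b) fun _ => []
  have hrect : ∀ a b a' b', T a b = T a' b' → T a b' = T a b := fun a b a' b' h =>
    P.record_rectangle henc hinj f c hbr _ _ _ rfl rfl h
  let B := 2 * C + (n + 3) * Q + n + 3
  have hK : ∀ a b, T a b ∈ boolLists B := by
    intro a b
    refine mem_boolLists ?_
    have hl : ∀ α, (localBits enc k a b α).length = n + 2 := fun α => by simp [localBits, hlen]
    have h1 := hC _ _ (hinst a b)
    have h2 := hQ _ _ (hinst a b)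
    simp only [T]
    rw [P.length_record hl, show n + 2 + 1 = n + 3 from rfl]
    have h3 := Nat.mul_le_mul_left (n + 3) h2
    simp only [Protocol.run] at h1 h3
    simp only [B, br]
    omega
  have hsuff : ∀ a b, [true, true] <:+ T a b ↔
      a (k (P.run O (f a) (c b)).contract) = true ∧
      b (k (P.run O (f a) (c b)).contract) = true := fun a b =>
    suffix_localBits_iff (P.suffix_record (br a b) (f a) (c b) fun _ => [])
  -- The suffix exhibits a common index whether or not the output is optimal, so it never occurs on
  -- disjoint inputs, for which nothing is assumed about the output.
  have hacc := sum_accept_le hrect hK (fun t => [true, true] <:+ t)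
    (fun a b hab h => hab _ ((hsuff a b).1 h))
  rw [Fintype.card_fin] at hacc
  refine le_trans (sum_le_sum fun i _ => sum_le_sum fun d _ => ?_) (hacc.trans ?_)
  · refine Nat.cast_le.2 (card_le_card fun z hz => ?_)
    simp only [mem_filter, mem_univ, true_and] at hz ⊢
    rw [hsuff]
    have h := bits_of_isOptimalContract hn hidx hM hM2
      (oddBits_even (Function.update (leftPart d z) i true))
      (oddBits_even (Function.update (rightPart d z) i true))
      (j := 2 * i + 1) (by have := i.2; omega) (by rw [oddBits_odd]; simp)
      (by rw [oddBits_odd]; simp) (hgood i d z hz)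
    rwa [hk, hk] at h
  · refine mul_le_mul_of_nonneg_left ?_ (by positivity)
    have hpos : 0 < #(boolLists B) := card_pos.2 ⟨_, hK (fun _ => true) fun _ => true⟩
    calc Real.log #(boolLists B) ≤ Real.log ((2 : ℝ) ^ (B + 1)) :=
          Real.log_le_log (by exact_mod_cast hpos) (by exact_mod_cast card_boolLists_le B)
      _ = _ := by rw [Real.log_pow]

end Reduction

/-! ### Averaging over the randomness, and asymptotics. -/

section Counting

/-- Averaging: events that never occur more than `B` at a time have total probability at most
`B`. -/
theorem sum_measureReal_le {Ω X : Type*} [MeasurableSpace Ω] (μ : Measure Ω)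
    [IsProbabilityMeasure μ] [Fintype X] (A : X → Set Ω) [∀ x, DecidablePred (· ∈ A x)]
    (hA : ∀ x, MeasurableSet (A x)) {B : ℝ} (h : ∀ ω, (#{x | ω ∈ A x} : ℝ) ≤ B) :
    ∑ x, μ.real (A x) ≤ B := by
  have hint : ∀ x ∈ (univ : Finset X), Integrable ((A x).indicator (1 : Ω → ℝ)) μ :=
    fun x _ => (integrable_const (1 : ℝ)).indicator (hA x)
  calc ∑ x, μ.real (A x) = ∑ x, ∫ ω, (A x).indicator (1 : Ω → ℝ) ω ∂μ :=
        sum_congr rfl fun x _ => (integral_indicator_one (hA x)).symm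
    _ = ∫ ω, ∑ x, (A x).indicator (1 : Ω → ℝ) ω ∂μ := (integral_finsetSum _ hint).symm
    _ ≤ ∫ _, B ∂μ := by
        refine integral_mono (integrable_finsetSum _ hint) (integrable_const B) fun ω => ?_
        refine le_trans (le_of_eq ?_) (h ω)
        simp [Set.indicator_apply]
    _ = B := by simp

theorem four_pow_le_sqrt_mul_centralBinom {m : ℕ} (hm : 1 ≤ m) :
    (4 : ℝ) ^ m ≤ 2 * √m * m.centralBinom := by
  have h : (16 : ℝ) ^ m ≤ 4 * m * (m.centralBinom : ℝ) ^ 2 := by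
    induction m, hm using Nat.le_induction with
    | base => norm_num [Nat.centralBinom]
    | succ m hm ih =>
      -- With this recurrence the induction step reduces to `4 * m * (m + 1) ≤ (2 * m + 1) ^ 2`.
      have hrec : ((m : ℝ) + 1) * (m + 1).centralBinom = 2 * (2 * m + 1) * m.centralBinom := by
        exact_mod_cast Nat.succ_mul_centralBinom_succ m
      have hm0 : (0 : ℝ) < (m : ℝ) + 1 := by positivity
      push_cast
      refine le_of_mul_le_mul_left ?_ hm0
      calc ((m : ℝ) + 1) * 16 ^ (m + 1) = 16 * (m + 1) * 16 ^ m := by ring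
        _ ≤ 16 * (m + 1) * (4 * m * (m.centralBinom : ℝ) ^ 2) := by gcongr
        _ ≤ 4 * (2 * (2 * m + 1) * (m.centralBinom : ℝ)) ^ 2 := by
            have : 0 ≤ (m.centralBinom : ℝ) ^ 2 := sq_nonneg _
            nlinarith
        _ = _ := by rw [← hrec]; ring
  have h2 : ((4 : ℝ) ^ m) ^ 2 ≤ (2 * √m * m.centralBinom) ^ 2 := by
    rw [mul_pow, mul_pow, Real.sq_sqrt (by positivity), ← pow_mul, mul_comm m 2, pow_mul]
    norm_num
    linarith
  exact le_of_sq_le_sq h2 (by positivity)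

theorem two_pow_le_sqrt_mul_choose {n : ℕ} (hn : 2 ≤ n) :
    (2 : ℝ) ^ n ≤ 4 * √n * n.choose (midLevel n) := by
  have hm : 1 ≤ midLevel n := by unfold midLevel; omega
  have h1 := four_pow_le_sqrt_mul_centralBinom hm
  have h2 : (midLevel n).centralBinom ≤ n.choose (midLevel n) :=
    Nat.choose_le_choose _ (by unfold midLevel; omega)
  have h3 : √(midLevel n : ℝ) ≤ √n :=
    Real.sqrt_le_sqrt (by exact_mod_cast (by unfold midLevel; omega : midLevel n ≤ n))
  calc (2 : ℝ) ^ n ≤ 2 ^ (2 * midLevel n + 1) :=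
        pow_le_pow_right₀ (by norm_num) (by unfold midLevel; omega)
    _ = 2 * 4 ^ midLevel n := by rw [pow_succ, pow_mul]; norm_num; ring
    _ ≤ 2 * (2 * √(midLevel n) * (midLevel n).centralBinom) := by gcongr
    _ ≤ 2 * (2 * √n * n.choose (midLevel n)) := by gcongr
    _ = _ := by ring

theorem eventually_eval_lt_two_pow (r : Polynomial ℕ) :
    ∀ᶠ n : ℕ in Filter.atTop, ((r.eval n : ℕ) : ℝ) < 2 ^ n := by
  have h : Filter.Tendsto (fun n : ℕ => ((r.eval n : ℕ) : ℝ) / 2 ^ n) Filter.atTop (nhds 0) := by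
    induction r using Polynomial.induction_on' with
    | add p q hp hq =>
      have := hp.add hq
      simp only [add_zero] at this
      refine this.congr fun n => ?_
      rw [Polynomial.eval_add]; push_cast; ring
    | monomial k a =>
      have := (tendsto_pow_const_div_const_pow_of_one_lt k (by norm_num : (1 : ℝ) < 2)).const_mul
        (a : ℝ)
      rw [mul_zero] at this
      refine this.congr fun n => ?_
      rw [Polynomial.eval_monomial]; push_cast; ring
  filter_upwards [h.eventually_lt_const (by norm_num : (0 : ℝ) < 1)] with n hn
  rwa [div_lt_one (by positivity)] at hn

end Counting

end TwoPartyContract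

/-! ### The lower bound. -/

open TwoPartyContract

theorem mainTheorem2 :
    ∃ b : Polynomial ℕ, ∃ κ : ℝ, 0 < κ ∧
      ∀ q : Polynomial ℕ, ∃ n₀ : ℕ, ∀ n : ℕ, n₀ ≤ n →
        ∀ (O : BestResponseOracle n) (Ω : Type) [MeasurableSpace Ω] (μ : Measure Ω)
          [IsProbabilityMeasure μ] (P : Ω → Protocol n),
          ComputesOptimalContract (b.eval n) O μ P →
          MakesAtMostQueries (b.eval n) O P (q.eval n) →
          ∃ f c : SetFun n, IsInstance n (b.eval n) f c ∧
            ∃ ω : Ω, κ * (2 ^ n / Real.sqrt n) ≤ (((P ω).run O f c).bits : ℝ) := by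
  classical
  -- Fewer than `x` bits everywhere would give `N ≤ 17 * (2 * x + r)` with `r` polynomial in `n`,
  -- while `2 ^ n / √n ≤ 4 * M ≤ 8 * N + 4`. With `544 = 2 * 8 * 34` the term in `x` is half of `2 ^
  -- n / √n`, and the rest is polynomial.
  refine ⟨8 * Polynomial.X + 24, 1 / 544, by norm_num, fun q => ?_⟩
  obtain ⟨n₀, hn₀⟩ := Filter.eventually_atTop.1 (eventually_eval_lt_two_pow
    (16 * Polynomial.X * (17 * ((Polynomial.X + 3) * q + Polynomial.X + 4) + 1)))
  refine ⟨max n₀ 2, fun n hn O Ω _ μ _ P hcomp hquery => ?_⟩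
  have hn2 : 2 ≤ n := le_of_max_le_right hn
  have hlarge := hn₀ n (le_of_max_le_left hn)
  have hb : (8 * Polynomial.X + 24 : Polynomial ℕ).eval n = 8 * n + 24 := by simp
  have hr : (16 * Polynomial.X * (17 * ((Polynomial.X + 3) * q + Polynomial.X + 4) + 1) :
      Polynomial ℕ).eval n = 16 * n * (17 * ((n + 3) * q.eval n + n + 4) + 1) := by simp
  rw [hb] at hcomp hquery ⊢
  rw [hr] at hlarge
  by_contra! hcon
  set M := n.choose (midLevel n) with hM
  obtain ⟨idx, hidx⟩ := exists_isIndexing n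
  rw [← hM] at hidx
  have hM2 : M ≤ 2 ^ n := Nat.choose_le_two_pow n _
  have hM1 : 2 ≤ M := by
    have h1 : n.choose 1 ≤ M := by
      have := Nat.choose_le_middle 1 n
      exact this
    rw [Nat.choose_one_right] at h1
    omega
  obtain ⟨N, hN⟩ : ∃ N, N = M / 2 := ⟨_, rfl⟩
  set x : ℝ := 1 / 544 * (2 ^ n / √n) with hx
  have hsqrt : 0 < √(n : ℝ) := Real.sqrt_pos.2 (by exact_mod_cast (by omega : 0 < n))
  have hx0 : 0 ≤ x := by positivity
  let F : (Fin N → Bool) → SetFun n := fun a => hardReward n idx (oddBits a)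
  let G : (Fin N → Bool) → SetFun n := fun b => hardCost n idx (oddBits b)
  have hinst : ∀ a b, IsInstance n (8 * n + 24) (F a) (G b) :=
    fun a b => isInstance_hard hn2 hM2 hidx (oddBits_even b)
  -- One event for each planted input: the coordinate, the owners `d` and the free bits `z`.
  let A : Fin N × (Fin N → Bool) × (Fin N → Bool) → Set Ω := fun y =>
    {ω | IsOptimalContract (F (Function.update (leftPart y.2.1 y.2.2) y.1 true))
      (G (Function.update (rightPart y.2.1 y.2.2) y.1 true))
      ((P ω).run O (F (Function.update (leftPart y.2.1 y.2.2) y.1 true))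
        (G (Function.update (rightPart y.2.1 y.2.2) y.1 true))).contract}
  set E : ℝ := 16 * (2 ^ N * 2 ^ N) *
    ((2 * ⌊x⌋₊ + (n + 3) * q.eval n + n + 4 : ℕ) * Real.log 2) with hE
  have hcount : ∀ ω, ((Finset.univ.filter fun y => ω ∈ A y).card : ℝ) ≤ E := by
    intro ω
    have := sum_card_optimal_le hn2 hidx hM1 hM2 hN O (P ω)
      (C := ⌊x⌋₊) (Q := q.eval n) (fun f c h => Nat.le_floor (hcon f c h ω).le)
      (fun f c h => hquery f c h ω) (fun i d z => ω ∈ A (i, d, z)) (fun i d z h => h)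
    refine le_trans (le_of_eq ?_) this
    simp only [Finset.card_filter, Fintype.sum_prod_type]
    push_cast
    rfl
  have hsum := sum_measureReal_le μ A (fun y => (hcomp _ _ (hinst _ _)).1) hcount
  have hprob : ∀ y, 2 / 3 ≤ μ.real (A y) := by
    intro y
    have := ENNReal.toReal_mono (measure_ne_top μ _) (hcomp _ _ (hinst
      (Function.update (leftPart y.2.1 y.2.2) y.1 true)
      (Function.update (rightPart y.2.1 y.2.2) y.1 true))).2
    have h23 : (2 / 3 : ENNReal).toReal = 2 / 3 := by simp [ENNReal.toReal_div]
    rw [h23] at this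
    exact this
  have hlow : (N : ℝ) * (2 ^ N * 2 ^ N) * (2 / 3) ≤ E := by
    refine le_trans ?_ hsum
    refine le_trans (le_of_eq ?_) (Finset.card_nsmul_le_sum _ _ _ fun y _ => hprob y)
    simp [nsmul_eq_mul]
  -- The factor is `16 * 0.7 * 3 / 2 = 16.8`, with `log 2 < 0.7`.
  have hmain : (N : ℝ) ≤ 17 * (2 * x + ((n + 3) * q.eval n + n + 4 : ℕ)) := by
    have hfl : (⌊x⌋₊ : ℝ) ≤ x := Nat.floor_le hx0
    have hlog := Real.log_two_lt_d9
    have hpow : (0 : ℝ) < 2 ^ N * 2 ^ N := by positivity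
    have h1 : (N : ℝ) * (2 / 3) ≤
        16 * ((2 * ⌊x⌋₊ + (n + 3) * q.eval n + n + 4 : ℕ) * Real.log 2) := by
      refine le_of_mul_le_mul_left ?_ hpow
      rw [hE] at hlow
      linarith
    have h2 : ((2 * ⌊x⌋₊ + (n + 3) * q.eval n + n + 4 : ℕ) : ℝ) ≤
        2 * x + ((n + 3) * q.eval n + n + 4 : ℕ) := by
      push_cast; linarith
    have h3 : (0 : ℝ) ≤ 2 * x + ((n + 3) * q.eval n + n + 4 : ℕ) := by positivity
    have h4 : ((2 * ⌊x⌋₊ + (n + 3) * q.eval n + n + 4 : ℕ) : ℝ) * Real.log 2 ≤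
        (2 * x + ((n + 3) * q.eval n + n + 4 : ℕ)) * 0.7 := by
      refine mul_le_mul h2 (by linarith) (Real.log_pos (by norm_num)).le h3
    linarith
  have hNM : (M : ℝ) ≤ 2 * N + 1 := by exact_mod_cast (by omega : M ≤ 2 * N + 1)
  have hchoose := two_pow_le_sqrt_mul_choose hn2
  rw [← hM] at hchoose
  set y : ℝ := 2 ^ n / √n with hy
  have hyM : y ≤ 4 * M := by
    rw [hy, div_le_iff₀ hsqrt]; linarith
  have hny : (2 : ℝ) ^ n ≤ n * y := by
    rw [hy, ← mul_div_assoc, le_div_iff₀ hsqrt, mul_comm]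
    refine mul_le_mul_of_nonneg_right ?_ (by positivity)
    rw [Real.sqrt_le_left (by positivity)]
    have : (1 : ℝ) ≤ n := by exact_mod_cast (by omega : 1 ≤ n)
    nlinarith
  have hyr : y ≤ 16 * (17 * ((n + 3) * q.eval n + n + 4 : ℕ) + 1) := by
    rw [hx] at hmain
    linarith
  have hn0 : (0 : ℝ) ≤ n := by positivity
  have := mul_le_mul_of_nonneg_left hyr hn0
  push_cast at hlarge this
  linarith
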